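/- Let $H$ be a Hilbert space and $Y$ a Banach space, both over $\mathbb{K}=\mathbb{R}$ or both over $\mathbb{K}=\mathbb{C}$, and let $\phi : H \to Y$ be a bounded linear operator. For $k\ge 1$ let $H^{\otimes_h k}$ be the $k$-fold algebraic tensor power of $H$ with its canonical inner product $\langle x_1\otimes\cdots\otimes x_k,\,y_1\otimes\cdots\otimes y_k\rangle=\prod_i\langle x_i,y_i\rangle$, and let $Y^{\otimes_\pi k}$ be the $k$-fold algebraic tensor power of $Y$ with the projective norm $\|z\|_\pi=\inf\{\sum_j\prod_{i=1}^k\|y_{j,i}\| : z=\sum_j y_{j,1}\otimes\cdots\otimes y_{j,k}\}$ (finite sums). Let $\|\phi^{\otimes k}\|_{h\to\pi}\in[0,\infty]$ be the operator norm of $\phi^{\otimes k}: H^{\otimes_h k}\to Y^{\otimes_\pi k}$, which is $+\infty$ if this operator is unbounded. For a bounded operator $T:X\to Z$ between Banach spaces let $\pi_2(T)\in[0,\infty]$ be the $2$-summing norm, that is, the infimum of all $C\ge 0$ such that $$\Big(\sum_i\|T(x_i)\|^2\Big)^{1/2}\le C\,\sup_{f\in X^*,\ \|f\|\le 1}\Big(\sum_i|f(x_i)|^2\Big)^{1/2}$$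 for every finite family $(x_i)$ in $X$ ($+\infty$ if there is no such $C$). Let $\phi^*:Y^*\to H^*$, $f\mapsto f\circ\phi$, be the adjoint. Then $$\limsup_{k\to\infty}\|\phi^{\otimes k}\|_{h\to\pi}^{1/k}\le\pi_2(\phi^*).$$ If moreover $H$ and $Y$ are finite-dimensional, then the limit exists and $$\lim_{k\to\infty}\|\phi^{\otimes k}\|_{h\to\pi}^{1/k}=\pi_2(\phi^*).$$ -/

import Mathlib

open Filter Topology
open scoped ENNReal NNReal TensorProduct

namespace TensorRadius

variable {𝕜 : Type*} [RCLike 𝕜]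

section Hilbert

variable {H : Type*} [NormedAddCommGroup H] [InnerProductSpace 𝕜 H] {k : ℕ}

/-- The `𝕜`-multilinear form `x ↦ ∏ i, ⟪y i, x i⟫` on `H ^ k`. -/
noncomputable def innerProd (y : Fin k → H) : MultilinearMap 𝕜 (fun _ : Fin k => H) 𝕜 :=
  (MultilinearMap.mkPiAlgebra 𝕜 (Fin k) 𝕜).compLinearMap (fun i => innerₛₗ 𝕜 (y i))

theorem innerProd_apply (y x : Fin k → H) :
    innerProd (𝕜 := 𝕜) y x = ∏ i, inner 𝕜 (y i) (x i) := by
  simp [innerProd]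

theorem star_innerProd (y x : Fin k → H) :
    star (innerProd (𝕜 := 𝕜) y x) = innerProd x y := by
  simp [innerProd_apply]

/-- The canonical inner product on the algebraic tensor power `H ⊗ ⋯ ⊗ H` (`k` factors),
conjugate-linear in the first and linear in the second variable: the biadditive map with
`⟪a • (x₁ ⊗ ⋯ ⊗ x_k), b • (y₁ ⊗ ⋯ ⊗ y_k)⟫ = conj a * b * ∏ i, ⟪x i, y i⟫`. -/
noncomputable def tensorInner (𝕜 H : Type*) [RCLike 𝕜] [NormedAddCommGroup H]
    [InnerProductSpace 𝕜 H] (k : ℕ) :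
    (⨂[𝕜]^k H) →+ ((⨂[𝕜]^k H) →ₗ[𝕜] 𝕜) :=
  PiTensorProduct.liftAddHom
    (fun p => star p.1 • PiTensorProduct.lift (innerProd (𝕜 := 𝕜) p.2))
    (by
      intro r f i hf
      ext y
      simp [← star_innerProd y, (innerProd y).map_coord_zero i hf])
    (by intro f; simp)
    (by
      intro _ r f i m₁ m₂
      ext y
      simp [← star_innerProd y, MultilinearMap.map_update_add, mul_add])
    (by intro r r' f; simp [add_smul])
    (by
      intro _ r f i r'
      ext y
      simp [← star_innerProd y, MultilinearMap.map_update_smul]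
      ring)

theorem tensorInner_smul_tprod (a b : 𝕜) (x y : Fin k → H) :
    tensorInner 𝕜 H k (a • PiTensorProduct.tprod 𝕜 x) (b • PiTensorProduct.tprod 𝕜 y)
      = star a * b * ∏ i, inner 𝕜 (x i) (y i) := by
  rw [← PiTensorProduct.tprodCoeff_eq_smul_tprod a x]
  change (star a • PiTensorProduct.lift (innerProd (𝕜 := 𝕜) x)) _ = _
  simp [innerProd_apply]
  ring

/-- The Hilbert space tensor norm `‖z‖_h = √⟪z, z⟫` on the algebraic tensor power. -/
noncomputable def hilbertNorm (z : ⨂[𝕜]^k H) : ℝ :=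
  Real.sqrt (RCLike.re (tensorInner 𝕜 H k z z))

end Hilbert

/-- The tensor power `φ ⊗ ⋯ ⊗ φ` (`k` factors) on algebraic tensor powers. -/
noncomputable def tensorPowerMap {X Y : Type*} [AddCommGroup X] [Module 𝕜 X] [AddCommGroup Y]
    [Module 𝕜 Y] (φ : X →ₗ[𝕜] Y) (k : ℕ) : (⨂[𝕜]^k X) →ₗ[𝕜] (⨂[𝕜]^k Y) :=
  PiTensorProduct.map (fun _ => φ)

/-- The operator norm, in `[0, ∞]`, of `φ ⊗ ⋯ ⊗ φ` (`k` factors) from `H ⊗ ⋯ ⊗ H` with the Hilbert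
space tensor norm to `Y ⊗ ⋯ ⊗ Y` with the projective tensor norm, which is the norm `‖·‖` that
Mathlib puts on tensor powers. It is `∞` if the operator is unbounded. -/
noncomputable def hilbertToProjNorm {H Y : Type*} [NormedAddCommGroup H] [InnerProductSpace 𝕜 H]
    [NormedAddCommGroup Y] [NormedSpace 𝕜 Y] (φ : H →L[𝕜] Y) (k : ℕ) : ℝ≥0∞ :=
  ⨅ (C : ℝ≥0) (_ : ∀ z : ⨂[𝕜]^k H,
    ‖tensorPowerMap (φ : H →ₗ[𝕜] Y) k z‖ ≤ C * hilbertNorm z), (C : ℝ≥0∞)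

/-- The weak `ℓ²` norm `sup_{‖f‖ ≤ 1} (∑ i, |f (x i)|²)^{1/2}` of a finite family, the supremum
being over the unit ball of the dual. -/
noncomputable def weakL2Norm (𝕜 : Type*) [RCLike 𝕜] {X : Type*} [NormedAddCommGroup X]
    [NormedSpace 𝕜 X] {n : ℕ} (x : Fin n → X) : ℝ≥0∞ :=
  ⨆ (f : StrongDual 𝕜 X) (_ : ‖f‖ ≤ 1), ENNReal.ofReal (Real.sqrt (∑ i, ‖f (x i)‖ ^ 2))

/-- The `2`-summing norm `π₂(φ)`, equal to `∞` if `φ` is not `2`-summing. -/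
noncomputable def twoSummingNorm {X Y : Type*} [NormedAddCommGroup X] [NormedSpace 𝕜 X]
    [NormedAddCommGroup Y] [NormedSpace 𝕜 Y] (φ : X →L[𝕜] Y) : ℝ≥0∞ :=
  ⨅ (C : ℝ≥0) (_ : ∀ (n : ℕ) (x : Fin n → X),
    ENNReal.ofReal (Real.sqrt (∑ i, ‖φ (x i)‖ ^ 2)) ≤ C * weakL2Norm 𝕜 x), (C : ℝ≥0∞)

/-- The Banach space adjoint `φ* : Y* → X*`, `f ↦ f ∘ φ`. -/
noncomputable def dualOp {X Y : Type*} [NormedAddCommGroup X] [NormedSpace 𝕜 X]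
    [NormedAddCommGroup Y] [NormedSpace 𝕜 Y] (φ : X →L[𝕜] Y) :
    StrongDual 𝕜 Y →L[𝕜] StrongDual 𝕜 X :=
  φ.precomp 𝕜

end TensorRadius

/-! Upper bound. Let C > π₂(φ*). On every finite orthonormal family, φ factors as an operator into
ℓ² of norm at most C followed by e_j ↦ y_j with ∑ ‖y_j‖² ≤ 1 (`exists_factorization`). This is
stable under tensor powers: the matrix part has norm at most C^k, and Cauchy–Schwarz against the
products ∏ ‖y_{J l}‖, whose ℓ² norm is at most 1, bounds the projective norm. Hence ‖φ^{⊗k}‖ ≤ C^k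
for every k (`norm_tensorPowerMap_le_of_factorization`). If the factorization failed, Hahn–Banach
separation would give functionals that violate the 2-summing inequality.

Lower bound. For 0 < a < π₂(φ*) there are g_i ∈ Y* of weak ℓ² norm at most 1 with S = ∑ ‖φ* g_i‖² >
a². Consider the forms ∑_I ε_I g_{I_1} ⊗ ⋯ ⊗ g_{I_k} with random signs. Their pullbacks under φ^{⊗k}
are represented by tensors of mean square Hilbert norm at least S^k. Their norms on unit balls of Y
are controlled by a finite net of n points, at the cost of a factor K^k with K > 1 arbitrary.
Summing 2p-th moments over the n^k grid points and using Khinchine costs only n^{k/(2p)} A^{1/(2p)},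
with A independent of k. By duality, a bound D for φ^{⊗k} satisfies S^{k/2} ≤ D K^k n^{k/(2p)}
A^{1/(2p)} (`exists_pow_le_of_norm_tensorPowerMap_le`). Taking K near 1 and p large gives D ≥ a^k
for large k. -/

namespace TensorRadius

/-! ### Rademacher sums -/

/-- The sign `±1` attached to a boolean. -/
def boolSign (b : Bool) : ℝ := if b then 1 else -1

/-- The signs are independent, so the sum factors into terms 2 cosh(c_i), and cosh t ≤ exp(t²/2). -/
theorem sum_exp_sum_boolSign_le {ι : Type*} [Fintype ι] [DecidableEq ι] (c : ι → ℝ) :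
    ∑ ε : ι → Bool, Real.exp (∑ i, boolSign (ε i) * c i)
      ≤ 2 ^ Fintype.card ι * Real.exp ((∑ i, c i ^ 2) / 2) := by
  have h1 : ∑ ε : ι → Bool, Real.exp (∑ i, boolSign (ε i) * c i)
      = ∏ i, (2 * Real.cosh (c i)) := by
    have := Finset.prod_univ_sum (fun _ : ι => (Finset.univ : Finset Bool))
      (fun i b => Real.exp (boolSign b * c i))
    rw [Fintype.piFinset_univ] at this
    simp_rw [Real.exp_sum, ← this]
    refine Finset.prod_congr rfl fun i _ => ?_
    simp [boolSign, Real.cosh_eq]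
    ring
  rw [h1, Finset.prod_mul_distrib, Finset.sum_div, Real.exp_sum]
  simp only [Finset.prod_const, Finset.card_univ]
  gcongr with i _
  exact Real.cosh_le_exp_half_sq _

theorem pow_two_mul_le_factorial_mul_exp (u : ℝ) (p : ℕ) :
    u ^ (2 * p) ≤ (2 * p).factorial * (Real.exp u + Real.exp (-u)) := by
  have h := Real.pow_div_factorial_le_exp |u| (abs_nonneg u) (2 * p)
  rw [div_le_iff₀ (by positivity), (even_two_mul p).pow_abs] at h
  have h2 : Real.exp |u| ≤ Real.exp u + Real.exp (-u) := by
    rcases abs_choice u with h | h <;> rw [h] <;> linarith [Real.exp_pos u, Real.exp_pos (-u)]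
  calc _ ≤ _ := h
    _ ≤ (Real.exp u + Real.exp (-u)) * _ := by gcongr
    _ = _ := mul_comm _ _

theorem sum_pow_sum_boolSign_le {ι : Type*} [Fintype ι] [DecidableEq ι] (p : ℕ) (c : ι → ℝ)
    (hc : ∑ i, c i ^ 2 ≤ 1) :
    ∑ ε : ι → Bool, (∑ i, boolSign (ε i) * c i) ^ (2 * p)
      ≤ ((2 * p).factorial * (2 * Real.exp (1 / 2))) * 2 ^ Fintype.card ι := by
  have h1 := sum_exp_sum_boolSign_le c
  have h2 := sum_exp_sum_boolSign_le (fun i => - c i)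
  simp only [mul_neg, Finset.sum_neg_distrib, neg_sq] at h2
  have h3 : Real.exp ((∑ i, c i ^ 2) / 2) ≤ Real.exp (1 / 2) := by gcongr
  calc _ ≤ ∑ ε : ι → Bool, ((2 * p).factorial : ℝ) * (Real.exp (∑ i, boolSign (ε i) * c i)
        + Real.exp (-∑ i, boolSign (ε i) * c i)) :=
        Finset.sum_le_sum fun ε _ => pow_two_mul_le_factorial_mul_exp _ p
    _ ≤ ((2 * p).factorial : ℝ) * (2 ^ Fintype.card ι * Real.exp (1 / 2)
        + 2 ^ Fintype.card ι * Real.exp (1 / 2)) := by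
        rw [← Finset.mul_sum, Finset.sum_add_distrib]
        gcongr
        · exact h1.trans (by gcongr)
        · exact h2.trans (by gcongr)
    _ = _ := by ring

/-- A Khinchine inequality: even moments of Rademacher sums with `ℓ²`-bounded coefficients are
bounded independently of the number of summands. -/
theorem exists_sum_norm_pow_sum_boolSign_le (𝕜 : Type*) [RCLike 𝕜] (p : ℕ) :
    ∃ A : ℝ, 0 < A ∧ ∀ (ι : Type) [Fintype ι] [DecidableEq ι] (c : ι → 𝕜), ∑ i, ‖c i‖ ^ 2 ≤ 1 →
      ∑ ε : ι → Bool, ‖∑ i, (boolSign (ε i) : 𝕜) * c i‖ ^ (2 * p) ≤ A * 2 ^ Fintype.card ι := by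
  refine ⟨2 ^ (p - 1) * (2 * ((2 * p).factorial * (2 * Real.exp (1 / 2)))), by positivity, ?_⟩
  intro ι _ _ c hc
  have hre : ∑ i, (RCLike.re (c i)) ^ 2 ≤ 1 := (Finset.sum_le_sum fun i _ => by
    rw [RCLike.norm_sq_eq_def]; nlinarith [sq_nonneg (RCLike.im (c i))]).trans hc
  have him : ∑ i, (RCLike.im (c i)) ^ 2 ≤ 1 := (Finset.sum_le_sum fun i _ => by
    rw [RCLike.norm_sq_eq_def]; nlinarith [sq_nonneg (RCLike.re (c i))]).trans hc
  have key : ∀ ε : ι → Bool, ‖∑ i, (boolSign (ε i) : 𝕜) * c i‖ ^ (2 * p)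
      ≤ 2 ^ (p - 1) * ((∑ i, boolSign (ε i) * RCLike.re (c i)) ^ (2 * p)
        + (∑ i, boolSign (ε i) * RCLike.im (c i)) ^ (2 * p)) := by
    intro ε
    have e1 : RCLike.re (∑ i, (boolSign (ε i) : 𝕜) * c i)
        = ∑ i, boolSign (ε i) * RCLike.re (c i) := by simp
    have e2 : RCLike.im (∑ i, (boolSign (ε i) : 𝕜) * c i)
        = ∑ i, boolSign (ε i) * RCLike.im (c i) := by simp
    rw [pow_mul, RCLike.norm_sq_eq_def, e1, e2, pow_mul, pow_mul, ← sq, ← sq]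
    exact add_pow_le (sq_nonneg _) (sq_nonneg _) p
  calc _ ≤ _ := Finset.sum_le_sum fun ε _ => key ε
    _ ≤ 2 ^ (p - 1) * (((2 * p).factorial * (2 * Real.exp (1 / 2))) * 2 ^ Fintype.card ι
        + ((2 * p).factorial * (2 * Real.exp (1 / 2))) * 2 ^ Fintype.card ι) := by
        rw [← Finset.mul_sum, Finset.sum_add_distrib]
        gcongr
        · exact sum_pow_sum_boolSign_le p _ hre
        · exact sum_pow_sum_boolSign_le p _ him
    _ = _ := by ring

/-- Orthogonality of independent signs. -/
theorem sum_boolSign_mul_boolSign {ι : Type*} [Fintype ι] [DecidableEq ι] (B : ι → ι → ℝ) :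
    ∑ ε : ι → Bool, ∑ i, ∑ j, boolSign (ε i) * boolSign (ε j) * B i j
      = 2 ^ Fintype.card ι * ∑ i, B i i := by
  have h : ∀ i j, ∑ ε : ι → Bool, boolSign (ε i) * boolSign (ε j)
      = if i = j then 2 ^ Fintype.card ι else 0 := by
    intro i j
    split_ifs with hij
    · subst hij
      have : ∀ b, boolSign b * boolSign b = 1 := by intro b; cases b <;> simp [boolSign]
      simp [this]
    -- Flipping the sign ε i alone negates the summand.
    · refine Finset.sum_involution (fun ε _ => Function.update ε i (!ε i)) ?_ ?_ (by simp) ?_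
      · intro ε _
        rw [Function.update_self, Function.update_of_ne (Ne.symm hij)]
        cases ε i <;> cases ε j <;> simp [boolSign]
      · intro ε _ _ he
        have := congrFun he i
        simp at this
      · intro ε _
        simp
  rw [Finset.sum_comm, Finset.mul_sum]
  refine Finset.sum_congr rfl fun i _ => ?_
  rw [Finset.sum_comm]
  simp_rw [← Finset.sum_mul, h]
  simp

/-! ### Nets for multilinear forms -/

/-- A finite set `N` in the unit ball of a finite-dimensional space that almost norms all
multilinear forms. -/
theorem exists_finset_norm_multilinearMap_le {𝕜 : Type*} [RCLike 𝕜] {E : Type*}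
    [NormedAddCommGroup E] [NormedSpace 𝕜 E] [FiniteDimensional 𝕜 E] {K : ℝ} (hK : 1 < K) :
    ∃ N : Finset E, (∀ x ∈ N, ‖x‖ ≤ 1) ∧ ∀ (k : ℕ) (f : MultilinearMap 𝕜 (fun _ : Fin k => E) 𝕜)
      (B : ℝ), (∀ x : Fin k → E, (∀ i, x i ∈ N) → ‖f x‖ ≤ B) →
      ∀ x : Fin k → E, (∀ i, ‖x i‖ ≤ 1) → ‖f x‖ ≤ K ^ k * B := by
  have hK0 : 0 < K := by linarith
  have : ProperSpace E := FiniteDimensional.proper_rclike 𝕜 E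
  -- With radius 1 - K⁻¹, approximation by net points gives ‖L‖ ≤ B + (1 - K⁻¹)‖L‖, that is ‖L‖ ≤ K
  -- B. A multilinear form then loses one factor K per variable.
  obtain ⟨t, hts, htf, hcov⟩ := finite_cover_balls_of_compact
    (isCompact_closedBall (0 : E) 1) (e := 1 - K⁻¹) (by
      have := inv_lt_one_of_one_lt₀ hK; linarith)
  have hlin : ∀ (L : E →ₗ[𝕜] 𝕜) (B : ℝ), (∀ x ∈ htf.toFinset, ‖L x‖ ≤ B) →
      ∀ x : E, ‖x‖ ≤ 1 → ‖L x‖ ≤ K * B := by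
    intro L B hB
    set L' : E →L[𝕜] 𝕜 := LinearMap.toContinuousLinearMap L with hL'
    have hB0 : 0 ≤ B := by
      obtain ⟨y, hy, -⟩ := Set.mem_iUnion₂.1 (hcov (Metric.mem_closedBall_self zero_le_one))
      exact (norm_nonneg _).trans (hB y (by simpa using hy))
    have hn : ∀ x : E, ‖x‖ ≤ 1 → ‖L' x‖ ≤ B + (1 - K⁻¹) * ‖L'‖ := by
      intro x hx
      obtain ⟨y, hy, hxy⟩ := Set.mem_iUnion₂.1 (hcov (show x ∈ Metric.closedBall 0 1 by simpa))
      have h1 : L' x = L' y + L' (x - y) := by simp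
      have h2 : ‖L' (x - y)‖ ≤ ‖L'‖ * (1 - K⁻¹) := by
        refine (L'.le_opNorm _).trans ?_
        gcongr
        rw [← dist_eq_norm]
        exact (Metric.mem_ball.1 hxy).le
      have h3 : ‖L' y‖ ≤ B := hB y (by simpa using hy)
      rw [h1]
      linarith [norm_add_le (L' y) (L' (x - y))]
    have hop : ‖L'‖ ≤ B + (1 - K⁻¹) * ‖L'‖ := by
      refine ContinuousLinearMap.opNorm_le_of_unit_norm (𝕜 := 𝕜) ?_ ?_
      · have := inv_lt_one_of_one_lt₀ hK
        have : 0 ≤ 1 - K⁻¹ := by linarith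
        positivity
      · exact fun x hx => hn x hx.le
    have hop' : ‖L'‖ ≤ K * B := by
      have : K⁻¹ * ‖L'‖ ≤ B := by linarith
      rwa [inv_mul_le_iff₀ hK0] at this
    intro x hx
    calc ‖L x‖ = ‖L' x‖ := rfl
      _ ≤ ‖L'‖ * ‖x‖ := L'.le_opNorm x
      _ ≤ ‖L'‖ * 1 := by gcongr
      _ ≤ K * B := by linarith
  refine ⟨htf.toFinset, fun x hx => by simpa using hts (by simpa using hx), ?_⟩
  intro k
  induction k with
  | zero =>
    intro f B hB x _
    simpa using hB x (fun i => i.elim0)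
  | succ k ih =>
    intro f B hB x hx
    have h1 : ∀ y ∈ htf.toFinset, ‖f (Fin.cons y (Fin.tail x))‖ ≤ K ^ k * B := by
      intro y hy
      have := ih (f.curryLeft y) B (fun z hz => by
        rw [MultilinearMap.curryLeft_apply]
        refine hB _ (fun i => ?_)
        refine Fin.cases ?_ (fun i => ?_) i
        · simpa using hy
        · simpa using hz i) (Fin.tail x) (fun i => hx _)
      simpa using this
    have h2 := hlin (f.toLinearMap x 0) (K ^ k * B) (fun y hy => by
      have : Function.update x 0 y = Fin.cons y (Fin.tail x) := by
        conv_lhs => rw [← Fin.cons_self_tail x]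
        rw [Fin.update_cons_zero]
      rw [MultilinearMap.toLinearMap_apply, this]
      exact h1 y hy) (x 0) (hx 0)
    rw [MultilinearMap.toLinearMap_apply, Function.update_eq_self] at h2
    rw [pow_succ']
    linarith

/-! ### Lower bound by random tensors -/

section RandomTensor

variable {𝕜 : Type*} [RCLike 𝕜]

/-- The multilinear form `∑ I, ε I * g (I 0) ⊗ ⋯ ⊗ g (I (k-1))` with signs `ε`. -/
noncomputable def signForm {Y : Type*} [NormedAddCommGroup Y] [NormedSpace 𝕜 Y] {m k : ℕ}
    (g : Fin m → StrongDual 𝕜 Y) (ε : (Fin k → Fin m) → Bool) :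
    MultilinearMap 𝕜 (fun _ : Fin k => Y) 𝕜 :=
  ∑ I : Fin k → Fin m, (boolSign (ε I) : 𝕜) •
    (MultilinearMap.mkPiAlgebra 𝕜 (Fin k) 𝕜).compLinearMap (fun l => (g (I l)).toLinearMap)

theorem signForm_apply {Y : Type*} [NormedAddCommGroup Y] [NormedSpace 𝕜 Y] {m k : ℕ}
    (g : Fin m → StrongDual 𝕜 Y) (ε : (Fin k → Fin m) → Bool) (y : Fin k → Y) :
    signForm g ε y = ∑ I : Fin k → Fin m, (boolSign (ε I) : 𝕜) * ∏ l, g (I l) (y l) := by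
  simp [signForm]

/-- The tensor `∑ I, ε I • h (I 0) ⊗ ⋯ ⊗ h (I (k-1))` with signs `ε`. -/
noncomputable def signTensor {H : Type*} [NormedAddCommGroup H] [InnerProductSpace 𝕜 H] {m k : ℕ}
    (h : Fin m → H) (ε : (Fin k → Fin m) → Bool) : ⨂[𝕜]^k H :=
  ∑ I : Fin k → Fin m, (boolSign (ε I) : 𝕜) • PiTensorProduct.tprod 𝕜 (fun l => h (I l))

theorem tensorInner_tprod {H : Type*} [NormedAddCommGroup H] [InnerProductSpace 𝕜 H] {k : ℕ}
    (a : 𝕜) (x y : Fin k → H) :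
    tensorInner 𝕜 H k (a • PiTensorProduct.tprod 𝕜 x) (PiTensorProduct.tprod 𝕜 y)
      = star a * ∏ i, inner 𝕜 (x i) (y i) := by
  simpa using tensorInner_smul_tprod a 1 x y

/-- By Riesz representation, the sign tensor represents the pullback of the sign form under φ^{⊗k};
conjugation in the first slot leaves the real signs unchanged. -/
theorem tensorInner_signTensor {H : Type*} [NormedAddCommGroup H] [InnerProductSpace 𝕜 H]
    [CompleteSpace H] {Y : Type*} [NormedAddCommGroup Y] [NormedSpace 𝕜 Y] (φ : H →L[𝕜] Y)
    {m k : ℕ} (g : Fin m → StrongDual 𝕜 Y) (ε : (Fin k → Fin m) → Bool) (z : ⨂[𝕜]^k H) :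
    tensorInner 𝕜 H k
        (signTensor (fun i => (InnerProductSpace.toDual 𝕜 H).symm ((g i).comp φ)) ε) z
      = PiTensorProduct.lift (signForm g ε) (tensorPowerMap (φ : H →ₗ[𝕜] Y) k z) := by
  have : tensorInner 𝕜 H k
        (signTensor (fun i => (InnerProductSpace.toDual 𝕜 H).symm ((g i).comp φ)) ε)
      = PiTensorProduct.lift (signForm g ε) ∘ₗ (tensorPowerMap (φ : H →ₗ[𝕜] Y) k) := by
    ext x
    simp only [LinearMap.compMultilinearMap_apply, LinearMap.comp_apply, tensorPowerMap,
      PiTensorProduct.map_tprod, PiTensorProduct.lift.tprod, signForm_apply, signTensor, map_sum,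
      LinearMap.sum_apply]
    refine Finset.sum_congr rfl fun I _ => ?_
    rw [tensorInner_tprod]
    simp [InnerProductSpace.toDual_symm_apply]
  rw [this, LinearMap.comp_apply]

theorem norm_lift_le_of_unit_ball {Y : Type*} [NormedAddCommGroup Y] [NormedSpace 𝕜 Y] {k : ℕ}
    (f : MultilinearMap 𝕜 (fun _ : Fin k => Y) 𝕜) {B : ℝ}
    (hf : ∀ y : Fin k → Y, (∀ i, ‖y i‖ ≤ 1) → ‖f y‖ ≤ B) (t : ⨂[𝕜]^k Y) :
    ‖PiTensorProduct.lift f t‖ ≤ B * ‖t‖ := by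
  have hB : 0 ≤ B := (norm_nonneg _).trans (hf 0 (by simp))
  have hb : ∀ y : Fin k → Y, ‖f y‖ ≤ B * ∏ i, ‖y i‖ := by
    intro y
    have h1 : y = fun i => (‖y i‖ : 𝕜) • ((‖y i‖ : 𝕜)⁻¹ • y i) := by
      funext i
      by_cases h : y i = 0
      · simp [h]
      · rw [smul_smul, mul_inv_cancel₀ (by simpa using h), one_smul]
    have h2 : f y = (∏ i, (‖y i‖ : 𝕜)) * f (fun i => (‖y i‖ : 𝕜)⁻¹ • y i) := by
      conv_lhs => rw [h1]
      rw [f.map_smul_univ, smul_eq_mul]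
    have h3 := hf (fun i => (‖y i‖ : 𝕜)⁻¹ • y i) (fun i => by
      rw [norm_smul]
      simpa using inv_mul_le_one (G₀ := ℝ))
    rw [h2, norm_mul, norm_prod, mul_comm]
    simp only [RCLike.norm_ofReal, abs_norm]
    gcongr
  have h := PiTensorProduct.norm_eval_le_projectiveSeminorm (f.mkContinuous B hb) t
  exact h.trans (by gcongr; exact f.mkContinuous_norm_le hB hb)

/-- For the sign tensor z, ⟪z, z⟫ is the sign form at φ^{⊗k} z, hence at most B D ‖z‖_h; divide by
‖z‖_h. -/
theorem hilbertNorm_signTensor_le {H : Type*} [NormedAddCommGroup H] [InnerProductSpace 𝕜 H]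
    [CompleteSpace H] {Y : Type*} [NormedAddCommGroup Y] [NormedSpace 𝕜 Y] (φ : H →L[𝕜] Y)
    {m k : ℕ} (g : Fin m → StrongDual 𝕜 Y) (ε : (Fin k → Fin m) → Bool) {B D : ℝ} (hD : 0 ≤ D)
    (hφ : ∀ z : ⨂[𝕜]^k H, ‖tensorPowerMap (φ : H →ₗ[𝕜] Y) k z‖ ≤ D * hilbertNorm z)
    (hB : ∀ y : Fin k → Y, (∀ i, ‖y i‖ ≤ 1) → ‖signForm g ε y‖ ≤ B) :
    hilbertNorm (signTensor (𝕜 := 𝕜) (fun i => (InnerProductSpace.toDual 𝕜 H).symm ((g i).comp φ)) ε)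
      ≤ D * B := by
  have hB0 : 0 ≤ B := (norm_nonneg _).trans (hB 0 (by simp))
  set z := signTensor (𝕜 := 𝕜) (fun i => (InnerProductSpace.toDual 𝕜 H).symm ((g i).comp φ)) ε with hz
  rcases le_total (RCLike.re (tensorInner 𝕜 H k z z)) 0 with h | h
  · rw [hilbertNorm, Real.sqrt_eq_zero_of_nonpos h]
    positivity
  · have h1 : hilbertNorm z * hilbertNorm z = RCLike.re (tensorInner 𝕜 H k z z) :=
      Real.mul_self_sqrt h
    have h2 : RCLike.re (tensorInner 𝕜 H k z z) ≤ B * (D * hilbertNorm z) := by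
      refine (RCLike.re_le_norm _).trans ?_
      rw [hz, tensorInner_signTensor, ← hz]
      exact (norm_lift_le_of_unit_ball _ hB _).trans (by gcongr; exact hφ z)
    have hn : 0 ≤ hilbertNorm z := Real.sqrt_nonneg _
    rcases hn.eq_or_lt with h0 | h0
    · rw [← h0]; positivity
    · refine le_of_mul_le_mul_right ?_ h0
      linarith

/-- Averaging over the signs kills the off-diagonal terms of ⟪z, z⟫. An inequality suffices, which
avoids proving re ⟪z, z⟫ ≥ 0: the square root truncates negative values to 0. -/
theorem sum_hilbertNorm_signTensor_sq {H : Type*} [NormedAddCommGroup H] [InnerProductSpace 𝕜 H]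
    {m k : ℕ} (h : Fin m → H) :
    2 ^ Fintype.card (Fin k → Fin m) * (∑ i, ‖h i‖ ^ 2) ^ k
      ≤ ∑ ε : (Fin k → Fin m) → Bool, hilbertNorm (signTensor (𝕜 := 𝕜) h ε) ^ 2 := by
  have h1 : ∀ ε : (Fin k → Fin m) → Bool,
      ∑ I, ∑ J, boolSign (ε I) * boolSign (ε J) * RCLike.re (∏ l, inner 𝕜 (h (I l)) (h (J l)))
      ≤ hilbertNorm (signTensor (𝕜 := 𝕜) h ε) ^ 2 := by
    intro ε
    have : ∑ I, ∑ J, boolSign (ε I) * boolSign (ε J) *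
        RCLike.re (∏ l, inner 𝕜 (h (I l)) (h (J l)))
        = RCLike.re (tensorInner 𝕜 H k (signTensor h ε) (signTensor h ε)) := by
      simp only [signTensor, map_sum, LinearMap.sum_apply]
      rw [Finset.sum_comm]
      refine Finset.sum_congr rfl fun I _ => Finset.sum_congr rfl fun J _ => ?_
      rw [tensorInner_smul_tprod]
      simp only [RCLike.star_def, RCLike.conj_ofReal]
      rw [← RCLike.ofReal_mul, RCLike.re_ofReal_mul]
    rw [this]
    rcases le_total (RCLike.re (tensorInner 𝕜 H k (signTensor h ε) (signTensor h ε))) 0 with h | h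
    · exact h.trans (sq_nonneg _)
    · rw [hilbertNorm, Real.sq_sqrt h]
  refine le_trans (le_of_eq ?_) (Finset.sum_le_sum fun ε _ => h1 ε)
  rw [sum_boolSign_mul_boolSign (fun I J : Fin k → Fin m =>
    RCLike.re (∏ l, inner 𝕜 (h (I l)) (h (J l)))), Fintype.sum_pow]
  congr 1
  refine Finset.sum_congr rfl fun I _ => ?_
  simp only [inner_self_eq_norm_sq_to_K]
  norm_cast

/-- The order of quantifiers matters: n depends only on Y and K, so p can be chosen after n, and A
does not depend on k. -/
theorem exists_pow_le_of_norm_tensorPowerMap_le {Y : Type*} [NormedAddCommGroup Y]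
    [NormedSpace 𝕜 Y] [FiniteDimensional 𝕜 Y] {K : ℝ} (hK : 1 < K) :
    ∃ n : ℕ, ∀ p : ℕ, 0 < p → ∃ A : ℝ, 0 < A ∧ ∀ {H : Type*} [NormedAddCommGroup H]
      [InnerProductSpace 𝕜 H] [CompleteSpace H] (φ : H →L[𝕜] Y) {m : ℕ}
      (g : Fin m → StrongDual 𝕜 Y), (∀ y : Y, ‖y‖ ≤ 1 → ∑ i, ‖g i y‖ ^ 2 ≤ 1) →
      ∀ (k : ℕ) (D : ℝ), 0 ≤ D →
      (∀ z : ⨂[𝕜]^k H, ‖tensorPowerMap (φ : H →ₗ[𝕜] Y) k z‖ ≤ D * hilbertNorm z) →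
      ((∑ i, ‖(g i).comp φ‖ ^ 2) ^ k) ^ p ≤ (D * K ^ k) ^ (2 * p) * (n ^ k * A) := by
  obtain ⟨N, hN1, hN⟩ := exists_finset_norm_multilinearMap_le (𝕜 := 𝕜) (E := Y) hK
  refine ⟨N.card, fun p hp => ?_⟩
  obtain ⟨A, hA, hkh⟩ := exists_sum_norm_pow_sum_boolSign_le 𝕜 p
  refine ⟨A, hA, ?_⟩
  intro H _ _ _ φ m g hg k D hD hφ
  have hK0 : 0 < K := by linarith
  set M := Fintype.card (Fin k → Fin m) with hM
  set h : Fin m → H := fun i => (InnerProductSpace.toDual 𝕜 H).symm ((g i).comp φ) with hh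
  set P : Finset (Fin k → Y) := Fintype.piFinset (fun _ => N) with hP
  set T : ((Fin k → Fin m) → Bool) → ℝ := fun ε => ∑ ν ∈ P, ‖signForm g ε ν‖ ^ (2 * p) with hT
  have hT0 : ∀ ε, 0 ≤ T ε := fun ε => Finset.sum_nonneg fun ν _ => by positivity
  have h1 : ∀ ε, (hilbertNorm (signTensor (𝕜 := 𝕜) h ε) ^ 2) ^ p ≤ (D * K ^ k) ^ (2 * p) * T ε := by
    intro ε
    -- The ℓ^{2p} norm of the form on the grid dominates its maximum there.
    set b : ℝ := T ε ^ (((2 * p : ℕ) : ℝ)⁻¹) with hb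
    have hb0 : 0 ≤ b := Real.rpow_nonneg (hT0 ε) _
    have hbp : b ^ (2 * p) = T ε := Real.rpow_inv_natCast_pow (hT0 ε) (by omega)
    have h2 := hilbertNorm_signTensor_le φ g ε (B := K ^ k * b) hD hφ (by
      refine hN k _ b fun ν hν => ?_
      refine le_of_pow_le_pow_left₀ (n := 2 * p) (by omega) hb0 ?_
      rw [hbp]
      exact Finset.single_le_sum (f := fun ν => ‖signForm g ε ν‖ ^ (2 * p))
        (fun ν _ => by positivity) (by simpa [hP] using hν))
    calc _ = hilbertNorm (signTensor (𝕜 := 𝕜) h ε) ^ (2 * p) := by rw [pow_mul]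
      _ ≤ (D * (K ^ k * b)) ^ (2 * p) := by
        gcongr
        exact Real.sqrt_nonneg _
      _ = _ := by rw [← mul_assoc, mul_pow, hbp]
  have h3 : ∑ ε, T ε ≤ (N.card : ℝ) ^ k * (A * 2 ^ M) := by
    rw [Finset.sum_comm]
    -- At a fixed grid point the squared coefficients sum to ∏ l, ∑ i, ‖g i (ν l)‖² ≤ 1, so
    -- Khinchine applies.
    have : ∀ ν ∈ P, ∑ ε, ‖signForm g ε ν‖ ^ (2 * p) ≤ A * 2 ^ M := by
      intro ν hν
      simp_rw [signForm_apply]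
      refine hkh (Fin k → Fin m) (fun I => ∏ l, g (I l) (ν l)) ?_
      have e := Finset.prod_univ_sum (fun _ : Fin k => (Finset.univ : Finset (Fin m)))
        (fun l i => ‖g i (ν l)‖ ^ 2)
      rw [Fintype.piFinset_univ] at e
      simp only [norm_prod, ← Finset.prod_pow, ← e]
      refine Finset.prod_le_one (fun l _ => by positivity) fun l _ => hg _ (hN1 _ ?_)
      exact Fintype.mem_piFinset.1 hν l
    refine (Finset.sum_le_sum this).trans (le_of_eq ?_)
    simp [hP]
  have h4 := sum_hilbertNorm_signTensor_sq (𝕜 := 𝕜) (k := k) h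
  have h5 := Real.pow_arith_mean_le_arith_mean_pow (Finset.univ)
    (fun _ : (Fin k → Fin m) → Bool => ((2 : ℝ) ^ M)⁻¹)
    (fun ε => hilbertNorm (signTensor (𝕜 := 𝕜) h ε) ^ 2) (fun _ _ => by positivity)
    (by simp [hM]) (fun _ _ => by positivity) p
  rw [← Finset.mul_sum, ← Finset.mul_sum] at h5
  have hnorm : ∀ i, ‖h i‖ = ‖(g i).comp φ‖ := fun i => by simp [hh]
  simp only [hnorm] at h4
  have h2M : (0 : ℝ) < 2 ^ M := by positivity
  calc _ ≤ (((2 : ℝ) ^ M)⁻¹ * ∑ ε, hilbertNorm (signTensor (𝕜 := 𝕜) h ε) ^ 2) ^ p := by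
        gcongr
        rwa [le_inv_mul_iff₀ h2M]
    _ ≤ _ := h5
    _ ≤ ((2 : ℝ) ^ M)⁻¹ * ∑ ε, (D * K ^ k) ^ (2 * p) * T ε := by
        gcongr with ε _
        exact h1 ε
    _ ≤ ((2 : ℝ) ^ M)⁻¹ * ((D * K ^ k) ^ (2 * p) * ((N.card : ℝ) ^ k * (A * 2 ^ M))) := by
        rw [← Finset.mul_sum]
        gcongr
    _ = _ := by field_simp

theorem eventually_pow_le_of_norm_tensorPowerMap_le {H : Type*} [NormedAddCommGroup H]
    [InnerProductSpace 𝕜 H] [CompleteSpace H] {Y : Type*} [NormedAddCommGroup Y]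
    [NormedSpace 𝕜 Y] [FiniteDimensional 𝕜 Y] (φ : H →L[𝕜] Y) {m : ℕ}
    (g : Fin m → StrongDual 𝕜 Y) (hg : ∀ y : Y, ‖y‖ ≤ 1 → ∑ i, ‖g i y‖ ^ 2 ≤ 1) {a : ℝ}
    (ha : 0 < a) (hag : a ^ 2 < ∑ i, ‖(g i).comp φ‖ ^ 2) :
    ∀ᶠ k : ℕ in atTop, ∀ D : ℝ, 0 ≤ D →
      (∀ z : ⨂[𝕜]^k H, ‖tensorPowerMap (φ : H →ₗ[𝕜] Y) k z‖ ≤ D * hilbertNorm z) → a ^ k ≤ D := by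
  set S := ∑ i, ‖(g i).comp φ‖ ^ 2 with hS
  set ρ := S / a ^ 2 with hρ
  have ha2 : 0 < a ^ 2 := by positivity
  have hρ1 : 1 < ρ := by rwa [hρ, one_lt_div ha2]
  have hρ0 : 0 < ρ := by linarith
  obtain ⟨K, hK, hKρ⟩ : ∃ K : ℝ, 1 < K ∧ K ^ 2 < ρ := by
    have h1 : 1 < √ρ := by rwa [Real.lt_sqrt zero_le_one, one_pow]
    obtain ⟨K, h2, h3⟩ := exists_between h1
    exact ⟨K, h2, (Real.lt_sqrt (by linarith)).1 h3⟩
  have hK0 : 0 < K := by linarith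
  obtain ⟨n, hn⟩ := exists_pow_le_of_norm_tensorPowerMap_le (𝕜 := 𝕜) (Y := Y) hK
  have hq : 1 < ρ / K ^ 2 := by rwa [one_lt_div (by positivity)]
  -- This p makes the gain (ρ/K²)^p beat the entropy factor; n + 1 in place of n keeps the divisor
  -- positive and forces p > 0. The remaining ratio r > 1 absorbs A for large k.
  obtain ⟨p, hp⟩ := pow_unbounded_of_one_lt (n + 1 : ℝ) hq
  have hp0 : 0 < p := by
    rcases Nat.eq_zero_or_pos p with h | h
    · subst h
      have : (0 : ℝ) ≤ n := by positivity
      rw [pow_zero] at hp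
      linarith
    · exact h
  obtain ⟨A, hA, hmain⟩ := hn p hp0
  set r := (ρ / K ^ 2) ^ p / (n + 1) with hr
  have hr1 : 1 < r := by rwa [hr, one_lt_div (by positivity)]
  filter_upwards [(tendsto_pow_atTop_atTop_of_one_lt hr1).eventually_gt_atTop A] with k hk D hD hφ
  have h1 := hmain φ g hg k D hD hφ
  have hr' : S ^ p = a ^ (2 * p) * K ^ (2 * p) * (n + 1) * r := by
    rw [hr, hρ, pow_mul, pow_mul, div_pow, div_pow]
    field_simp
  refine le_of_pow_le_pow_left₀ (n := 2 * p) (by omega) hD ?_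
  have hpos : 0 < (K ^ k) ^ (2 * p) * ((n + 1 : ℝ) ^ k * A) := by positivity
  refine le_of_mul_le_mul_right ?_ hpos
  calc (a ^ k) ^ (2 * p) * ((K ^ k) ^ (2 * p) * ((n + 1 : ℝ) ^ k * A))
      ≤ (a ^ k) ^ (2 * p) * ((K ^ k) ^ (2 * p) * ((n + 1 : ℝ) ^ k * r ^ k)) := by gcongr
    _ = (S ^ p) ^ k := by rw [hr', mul_pow, mul_pow, mul_pow]; ring
    _ = (S ^ k) ^ p := by ring
    _ ≤ _ := h1
    _ ≤ (D * K ^ k) ^ (2 * p) * ((n + 1 : ℝ) ^ k * A) := by gcongr; linarith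
    _ = _ := by rw [mul_pow]; ring

end RandomTensor

/-! ### Orthonormal expansion of tensors -/

section OrthonormalExpansion

variable {𝕜 : Type*} [RCLike 𝕜] {H : Type*} [NormedAddCommGroup H] [InnerProductSpace 𝕜 H]

theorem exists_finiteDimensional_mem_range_map {k : ℕ} (z : ⨂[𝕜]^k H) :
    ∃ E : Submodule 𝕜 H, FiniteDimensional 𝕜 E ∧
      ∃ w : ⨂[𝕜]^k E, PiTensorProduct.map (fun _ : Fin k => E.subtype) w = z := by
  induction z using PiTensorProduct.induction_on with
  | smul_tprod r f =>
    refine ⟨Submodule.span 𝕜 (Set.range f), FiniteDimensional.span_of_finite 𝕜 (Set.finite_range f),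
      r • PiTensorProduct.tprod 𝕜 (fun i => ⟨f i, Submodule.subset_span ⟨i, rfl⟩⟩), ?_⟩
    simp
  | add x y hx hy =>
    obtain ⟨E, hE, u, rfl⟩ := hx
    obtain ⟨F, hF, v, rfl⟩ := hy
    refine ⟨E ⊔ F, inferInstance,
      PiTensorProduct.map (fun _ : Fin k => Submodule.inclusion (le_sup_left : E ≤ E ⊔ F)) u
      + PiTensorProduct.map (fun _ : Fin k => Submodule.inclusion (le_sup_right : F ≤ E ⊔ F)) v, ?_⟩
    rw [map_add, ← LinearMap.comp_apply, ← LinearMap.comp_apply, ← PiTensorProduct.map_comp,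
      ← PiTensorProduct.map_comp]
    rfl

/-- An algebraic tensor involves only finitely many vectors, so it lives on a finite-dimensional
subspace. -/
theorem exists_orthonormal_eq_sum_tprod {k : ℕ} (z : ⨂[𝕜]^k H) :
    ∃ (n : ℕ) (e : Fin n → H) (c : (Fin k → Fin n) → 𝕜), Orthonormal 𝕜 e ∧
      z = ∑ I, c I • PiTensorProduct.tprod 𝕜 (fun l => e (I l)) := by
  obtain ⟨E, hE, w, rfl⟩ := exists_finiteDimensional_mem_range_map z
  set b := stdOrthonormalBasis 𝕜 E
  set B := Basis.piTensorProduct (fun _ : Fin k => b.toBasis)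
  refine ⟨_, fun i => (b i : H), fun I => B.repr w I, ?_, ?_⟩
  · exact b.orthonormal.comp_linearIsometry E.subtypeₗᵢ
  · conv_lhs => rw [← B.sum_repr w]
    simp [B, map_sum, Basis.piTensorProduct_apply]

theorem hilbertNorm_sum_tprod_sq {k n : ℕ} {e : Fin n → H} (he : Orthonormal 𝕜 e)
    (c : (Fin k → Fin n) → 𝕜) :
    hilbertNorm (∑ I, c I • PiTensorProduct.tprod 𝕜 (fun l => e (I l))) ^ 2
      = ∑ I, ‖c I‖ ^ 2 := by
  have h : ∀ I J : Fin k → Fin n, ∏ l, inner 𝕜 (e (I l)) (e (J l)) = if I = J then 1 else 0 := by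
    intro I J
    simp only [orthonormal_iff_ite.1 he]
    split_ifs with hIJ
    · simp [hIJ]
    · obtain ⟨l, hl⟩ := Function.ne_iff.1 hIJ
      exact Finset.prod_eq_zero (Finset.mem_univ l) (if_neg hl)
  have h2 : RCLike.re (tensorInner 𝕜 H k (∑ I, c I • PiTensorProduct.tprod 𝕜 (fun l => e (I l)))
      (∑ I, c I • PiTensorProduct.tprod 𝕜 (fun l => e (I l)))) = ∑ I, ‖c I‖ ^ 2 := by
    simp only [map_sum, LinearMap.sum_apply, tensorInner_smul_tprod, h]
    refine Finset.sum_congr rfl fun I _ => ?_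
    rw [Finset.sum_eq_single I (fun J _ hJ => by simp [hJ]) (by simp), if_pos rfl, mul_one,
      RCLike.star_def, RCLike.conj_mul, ← RCLike.ofReal_pow, RCLike.ofReal_re]
  rw [hilbertNorm, Real.sq_sqrt, h2]
  rw [h2]
  positivity

end OrthonormalExpansion

/-! ### Tensor powers of a factorization -/

section KroneckerPower

variable {𝕜 : Type*} [RCLike 𝕜]

/-- The Kronecker power of a matrix with operator norm at most `C` has operator norm at most
`C ^ k`. -/
theorem sum_norm_sq_kroneckerPower_le {m n : ℕ} (a : Fin m → Fin n → 𝕜) {C : ℝ}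
    (ha : ∀ x : Fin n → 𝕜, ∑ j, ‖∑ i, a j i * x i‖ ^ 2 ≤ C ^ 2 * ∑ i, ‖x i‖ ^ 2) (k : ℕ)
    (c : (Fin k → Fin n) → 𝕜) :
    ∑ J : Fin k → Fin m, ‖∑ I : Fin k → Fin n, (∏ l, a (J l) (I l)) * c I‖ ^ 2
      ≤ (C ^ k) ^ 2 * ∑ I, ‖c I‖ ^ 2 := by
  induction k with
  | zero => simp
  | succ k ih =>
    have hm : ∀ (j : Fin m) (J : Fin k → Fin m),
        Fin.consEquiv (fun _ : Fin (k + 1) => Fin m) (j, J) = Fin.cons j J := fun _ _ => rfl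
    have hn : ∀ (i : Fin n) (I : Fin k → Fin n),
        Fin.consEquiv (fun _ : Fin (k + 1) => Fin n) (i, I) = Fin.cons i I := fun _ _ => rfl
    rw [← (Fin.consEquiv (fun _ : Fin (k + 1) => Fin m)).sum_comp, Fintype.sum_prod_type,
      ← (Fin.consEquiv (fun _ : Fin (k + 1) => Fin n)).sum_comp (fun I => ‖c I‖ ^ 2),
      Fintype.sum_prod_type]
    have h1 : ∀ (j : Fin m) (J : Fin k → Fin m),
        ∑ I : Fin (k + 1) → Fin n, (∏ l, a ((Fin.cons j J : Fin (k + 1) → Fin m) l) (I l)) * c I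
        = ∑ I : Fin k → Fin n, (∏ l, a (J l) (I l)) * ∑ i, a j i * c (Fin.cons i I) := by
      intro j J
      rw [← (Fin.consEquiv (fun _ : Fin (k + 1) => Fin n)).sum_comp, Fintype.sum_prod_type,
        Finset.sum_comm]
      refine Finset.sum_congr rfl fun I _ => ?_
      rw [Finset.mul_sum]
      refine Finset.sum_congr rfl fun i _ => ?_
      simp only [hn, Fin.prod_univ_succ, Fin.cons_zero, Fin.cons_succ]
      ring
    simp only [hm, hn, h1]
    calc _ ≤ ∑ j, (C ^ k) ^ 2 * ∑ I : Fin k → Fin n, ‖∑ i, a j i * c (Fin.cons i I)‖ ^ 2 :=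
          Finset.sum_le_sum fun j _ => ih _
      _ = (C ^ k) ^ 2 * ∑ I : Fin k → Fin n, ∑ j, ‖∑ i, a j i * c (Fin.cons i I)‖ ^ 2 := by
          rw [← Finset.mul_sum, Finset.sum_comm]
      _ ≤ (C ^ k) ^ 2 * ∑ I : Fin k → Fin n, C ^ 2 * ∑ i, ‖c (Fin.cons i I)‖ ^ 2 := by
          gcongr with I _
          exact ha _
      _ = _ := by
          rw [← Finset.mul_sum, Finset.sum_comm]
          ring

/-- If `φ` factors on every finite orthonormal family as a contraction of norm `C` into `ℓ²`
followed by `e_j ↦ y_j` with `∑ ‖y_j‖² ≤ 1`, then `‖φ ⊗ ⋯ ⊗ φ‖ ≤ C ^ k`. -/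
theorem norm_tensorPowerMap_le_of_factorization {H : Type*} [NormedAddCommGroup H]
    [InnerProductSpace 𝕜 H] {Y : Type*} [NormedAddCommGroup Y] [NormedSpace 𝕜 Y]
    (φ : H →L[𝕜] Y) {C : ℝ} (hC : 0 ≤ C)
    (hφ : ∀ (n : ℕ) (e : Fin n → H), Orthonormal 𝕜 e →
      ∃ (m : ℕ) (a : Fin m → Fin n → 𝕜) (y : Fin m → Y), (∀ i, φ (e i) = ∑ j, a j i • y j) ∧
        (∀ x : Fin n → 𝕜, ∑ j, ‖∑ i, a j i * x i‖ ^ 2 ≤ C ^ 2 * ∑ i, ‖x i‖ ^ 2) ∧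
        ∑ j, ‖y j‖ ^ 2 ≤ 1)
    (k : ℕ) (z : ⨂[𝕜]^k H) :
    ‖tensorPowerMap (φ : H →ₗ[𝕜] Y) k z‖ ≤ C ^ k * hilbertNorm z := by
  obtain ⟨n, e, c, he, rfl⟩ := exists_orthonormal_eq_sum_tprod z
  obtain ⟨m, a, y, hay, ha, hy⟩ := hφ n e he
  set z : ⨂[𝕜]^k H := ∑ I, c I • PiTensorProduct.tprod 𝕜 (fun l => e (I l)) with hz
  set d : (Fin k → Fin m) → 𝕜 := fun J => ∑ I, (∏ l, a (J l) (I l)) * c I with hd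
  have h1 : tensorPowerMap (φ : H →ₗ[𝕜] Y) k z
      = ∑ J, d J • PiTensorProduct.tprod 𝕜 (fun l => y (J l)) := by
    simp only [hz, tensorPowerMap, map_sum, map_smul, PiTensorProduct.map_tprod,
      ContinuousLinearMap.coe_coe, hay, MultilinearMap.map_sum, MultilinearMap.map_smul_univ, hd,
      Finset.smul_sum, Finset.sum_smul]
    rw [Finset.sum_comm]
    refine Finset.sum_congr rfl fun J _ => Finset.sum_congr rfl fun I _ => ?_
    rw [smul_smul, mul_comm]
  have h2 : ‖tensorPowerMap (φ : H →ₗ[𝕜] Y) k z‖ ≤ ∑ J, ‖d J‖ * ∏ l, ‖y (J l)‖ := by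
    rw [h1]
    refine (norm_sum_le _ _).trans (Finset.sum_le_sum fun J _ => ?_)
    rw [norm_smul]
    gcongr
    exact PiTensorProduct.projectiveSeminorm_tprod_le _
  have h3 : ∑ J : Fin k → Fin m, (∏ l, ‖y (J l)‖) ^ 2 ≤ 1 := by
    simp only [← Finset.prod_pow]
    rw [← Fintype.sum_pow (fun j => ‖y j‖ ^ 2) k]
    exact pow_le_one₀ (by positivity) hy
  have hn : 0 ≤ hilbertNorm z := Real.sqrt_nonneg _
  refine h2.trans (le_of_sq_le_sq ?_ (by positivity))
  calc _ ≤ (∑ J, ‖d J‖ ^ 2) * ∑ J : Fin k → Fin m, (∏ l, ‖y (J l)‖) ^ 2 :=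
        Finset.sum_mul_sq_le_sq_mul_sq _ _ _
    _ ≤ ((C ^ k) ^ 2 * ∑ I, ‖c I‖ ^ 2) * 1 := by
        gcongr
        exact sum_norm_sq_kroneckerPower_le a ha k c
    _ = _ := by rw [mul_one, mul_pow, hz, hilbertNorm_sum_tprod_sq he]

end KroneckerPower

/-! ### Hahn–Banach separation for factorizations -/

section Factorization

open Matrix
open scoped ComplexOrder MatrixOrder Matrix.Norms.L2Operator

variable {𝕜 : Type*} [RCLike 𝕜]

theorem re_star_dotProduct_vecMulVec {n : ℕ} (a x : Fin n → 𝕜) :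
    RCLike.re (star x ⬝ᵥ (vecMulVec (star a) a *ᵥ x)) = ‖∑ i, a i * x i‖ ^ 2 := by
  have h1 : star x ⬝ᵥ (vecMulVec (star a) a *ᵥ x) = star (a ⬝ᵥ x) * (a ⬝ᵥ x) := by
    rw [vecMulVec_mulVec, dotProduct_smul, star_dotProduct_star]
    simp
  rw [h1, RCLike.star_def, RCLike.conj_mul, ← RCLike.ofReal_pow, RCLike.ofReal_re]
  rfl

theorem re_star_dotProduct_self {n : ℕ} (x : Fin n → 𝕜) :
    RCLike.re (star x ⬝ᵥ x) = ∑ i, ‖x i‖ ^ 2 := by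
  simp only [dotProduct, Pi.star_apply, RCLike.star_def, RCLike.conj_mul, map_sum,
    ← RCLike.ofReal_pow, RCLike.ofReal_re]

/-- A real functional on matrices that is nonnegative on rank one positive matrices is, up to a
positive definite perturbation, the square of the norm of an invertible matrix. -/
theorem exists_isUnit_sum_norm_sq_mulVec_eq {n : ℕ} (μ : Matrix (Fin n) (Fin n) 𝕜 →ₗ[ℝ] ℝ)
    (hμ : ∀ a : Fin n → 𝕜, 0 ≤ μ (vecMulVec (star a) a)) {δ : ℝ} (hδ : 0 < δ) :
    ∃ R : Matrix (Fin n) (Fin n) 𝕜, IsUnit R ∧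
      ∀ a, ∑ i, ‖(R *ᵥ a) i‖ ^ 2 = μ (vecMulVec (star a) a) + δ * ∑ i, ‖a i‖ ^ 2 := by
  set ν : Module.Dual 𝕜 (Matrix (Fin n) (Fin n) 𝕜) := Module.Dual.extendRCLike μ with hν
  set N₀ : Matrix (Fin n) (Fin n) 𝕜 := Matrix.of fun i l => ν (Matrix.single i l 1) with hN₀
  have h0 : ∀ a : Fin n → 𝕜, RCLike.re (star a ⬝ᵥ (N₀ *ᵥ a)) = μ (vecMulVec (star a) a) := by
    intro a
    rw [← Module.Dual.re_extendRCLike_apply (𝕜 := 𝕜) μ, ← hν]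
    congr 1
    conv_rhs => rw [matrix_eq_sum_single (vecMulVec (star a) a)]
    have : ∀ i l, single i l (vecMulVec (star a) a i l) = (star a i * a l) • single i l (1 : 𝕜) := by
      intro i l
      simp [vecMulVec_apply]
    simp only [this, map_sum, map_smul, dotProduct, mulVec, hN₀, of_apply, Finset.mul_sum,
      smul_eq_mul]
    refine Finset.sum_congr rfl fun i _ => Finset.sum_congr rfl fun l _ => ?_
    simp only [Pi.star_apply]
    ring
  have h0' : ∀ a : Fin n → 𝕜, RCLike.re (star a ⬝ᵥ (N₀ᴴ *ᵥ a)) = μ (vecMulVec (star a) a) := by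
    intro a
    rw [← h0 a, ← RCLike.conj_re, ← RCLike.star_def, star_dotProduct, star_star, star_mulVec,
      conjTranspose_conjTranspose, dotProduct_mulVec, dotProduct_comm]
  -- Symmetrizing leaves the real part of the quadratic form unchanged, and δ makes it positive
  -- definite, so N = R* R with R invertible.
  set N : Matrix (Fin n) (Fin n) 𝕜 := ((1 / 2 : ℝ) : 𝕜) • (N₀ + N₀ᴴ) + (δ : 𝕜) • 1 with hN
  have hre : ∀ a : Fin n → 𝕜, RCLike.re (star a ⬝ᵥ (N *ᵥ a))
      = μ (vecMulVec (star a) a) + δ * ∑ i, ‖a i‖ ^ 2 := by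
    intro a
    rw [hN, add_mulVec, smul_mulVec, smul_mulVec, add_mulVec, one_mulVec, dotProduct_add,
      dotProduct_smul, dotProduct_smul, dotProduct_add, smul_eq_mul, smul_eq_mul, map_add,
      RCLike.re_ofReal_mul, RCLike.re_ofReal_mul, map_add, h0, h0', re_star_dotProduct_self]
    ring
  have hherm : N.IsHermitian := by
    rw [IsHermitian, hN]
    simp [conjTranspose_add, conjTranspose_smul, add_comm]
  have hpos : N.PosDef := by
    refine PosDef.of_dotProduct_mulVec_pos hherm fun a ha => ?_
    rw [RCLike.pos_iff, hre]
    refine ⟨?_, hherm.im_star_dotProduct_mulVec_self a⟩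
    obtain ⟨i, hi⟩ := Function.ne_iff.1 ha
    have : 0 < ∑ i, ‖a i‖ ^ 2 := Finset.sum_pos' (fun _ _ => by positivity)
      ⟨i, Finset.mem_univ i, by
        have : 0 < ‖a i‖ := norm_pos_iff.2 hi
        positivity⟩
    have := hμ a
    positivity
  obtain ⟨R, hR, hNR⟩ :=
    CStarAlgebra.isStrictlyPositive_iff_eq_star_mul_self.1 hpos.isStrictlyPositive
  refine ⟨R, hR, fun a => ?_⟩
  rw [← hre, hNR, ← re_star_dotProduct_self, star_mulVec, ← mulVec_mulVec, dotProduct_mulVec,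
    star_eq_conjTranspose, dotProduct_mulVec, dotProduct_mulVec]

/-- The convex cone whose separation from a multiple of `u` encodes the factorization of `u`. -/
def factorizationCone {Y : Type*} [NormedAddCommGroup Y] [NormedSpace 𝕜 Y] [NormedSpace ℝ Y]
    [IsScalarTower ℝ 𝕜 Y] {n : ℕ}
    (u : Fin n → Y) (C : ℝ) :
    PointedCone ℝ ((Fin n → Y) × Matrix (Fin n) (Fin n) 𝕜 × ℝ) where
  carrier := {v | ∃ t : ℝ, 0 ≤ t ∧ ∃ (m : ℕ) (a : Fin m → Fin n → 𝕜) (y : Fin m → Y),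
    (∀ i, v.1 i + (t : 𝕜) • u i = ∑ j, a j i • y j) ∧
    (∀ x : Fin n → 𝕜, ∑ j, ‖∑ i, a j i * x i‖ ^ 2
      ≤ RCLike.re (star x ⬝ᵥ (v.2.1 *ᵥ x)) + t * (C ^ 2 * ∑ i, ‖x i‖ ^ 2)) ∧
    ∑ j, ‖y j‖ ^ 2 ≤ v.2.2 + t}
  add_mem' := by
    rintro v w ⟨t, ht, m, a, y, h1, h2, h3⟩ ⟨t', ht', m', a', y', h1', h2', h3'⟩
    refine ⟨t + t', by positivity, m + m', Fin.append a a', Fin.append y y', ?_, ?_, ?_⟩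
    · intro i
      simp only [Fin.sum_univ_add, Fin.append_left, Fin.append_right, ← h1, ← h1', Prod.fst_add,
        Pi.add_apply, RCLike.ofReal_add, add_smul]
      abel
    · intro x
      simp only [Fin.sum_univ_add, Fin.append_left, Fin.append_right, Prod.snd_add, Prod.fst_add,
        add_mulVec, dotProduct_add, map_add]
      linarith [h2 x, h2' x]
    · simp only [Fin.sum_univ_add, Fin.append_left, Fin.append_right, Prod.snd_add]
      linarith
  zero_mem' := ⟨0, le_rfl, 0, fun j => j.elim0, fun j => j.elim0, by simp, by simp, by simp⟩
  smul_mem' := by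
    rintro ⟨c, hc⟩ v ⟨t, ht, m, a, y, h1, h2, h3⟩
    have hcc : ‖((√c : ℝ) : 𝕜)‖ ^ 2 = c := by
      rw [RCLike.norm_ofReal, sq_abs, Real.sq_sqrt hc]
    have hcc' : ((√c : ℝ) : 𝕜) * ((√c : ℝ) : 𝕜) = (c : 𝕜) := by
      rw [← RCLike.ofReal_mul, Real.mul_self_sqrt hc]
    refine ⟨c * t, by positivity, m, fun j i => ((√c : ℝ) : 𝕜) * a j i,
      -- Both factors take √c: the products a_j ⊗ y_j and both quadratic bounds then scale by c.
      fun j => ((√c : ℝ) : 𝕜) • y j, ?_, ?_, ?_⟩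
    · intro i
      have e : ∀ j, (((√c : ℝ) : 𝕜) * a j i) • ((√c : ℝ) : 𝕜) • y j = (c : 𝕜) • a j i • y j := by
        intro j
        rw [smul_smul, smul_smul, ← hcc']
        congr 1
        ring
      simp only [e, ← Finset.smul_sum, ← h1]
      rw [smul_add, smul_smul, RCLike.ofReal_mul]
      congr 1
      change c • v.1 i = _
      rw [← RCLike.real_smul_eq_coe_smul (K := 𝕜)]
    · intro x
      have e : ∀ j, ‖∑ i, ((√c : ℝ) : 𝕜) * a j i * x i‖ ^ 2 = c * ‖∑ i, a j i * x i‖ ^ 2 := by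
        intro j
        simp only [mul_assoc, ← Finset.mul_sum]
        rw [norm_mul, mul_pow, hcc]
      have e2 : RCLike.re (star x ⬝ᵥ ((c • v.2.1) *ᵥ x)) = c * RCLike.re (star x ⬝ᵥ (v.2.1 *ᵥ x)) := by
        rw [smul_mulVec, dotProduct_smul, RCLike.smul_re]
      simp only [e, ← Finset.mul_sum]
      change _ ≤ RCLike.re (star x ⬝ᵥ ((c • v.2.1) *ᵥ x)) + _
      rw [e2, mul_assoc, ← mul_add]
      exact mul_le_mul_of_nonneg_left (h2 x) hc
    · simp only [norm_smul, mul_pow, hcc, ← Finset.mul_sum]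
      change _ ≤ c * v.2.2 + c * t
      rw [← mul_add]
      exact mul_le_mul_of_nonneg_left h3 hc

/-- A multiple of the identity dominates -B; this supplies the cofinality required by the Riesz
extension theorem. -/
theorem re_star_dotProduct_mulVec_ge {n : ℕ} (B : Matrix (Fin n) (Fin n) 𝕜) :
    ∃ β : ℝ, 0 ≤ β ∧ ∀ x : Fin n → 𝕜,
      -(β * ∑ i, ‖x i‖ ^ 2) ≤ RCLike.re (star x ⬝ᵥ (B *ᵥ x)) := by
  refine ⟨∑ i, ∑ l, ‖B i l‖, by positivity, fun x => ?_⟩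
  have h1 : ‖star x ⬝ᵥ (B *ᵥ x)‖ ≤ (∑ i, ∑ l, ‖B i l‖) * ∑ i, ‖x i‖ ^ 2 := by
    rw [Finset.sum_mul]
    refine (norm_sum_le _ _).trans (Finset.sum_le_sum fun i _ => ?_)
    simp only [mulVec, dotProduct, Finset.mul_sum, Finset.sum_mul (ι := Fin n) _ (fun l => ‖B i l‖)]
    refine (norm_sum_le _ _).trans (Finset.sum_le_sum fun l _ => ?_)
    rw [norm_mul, norm_mul, Pi.star_apply, norm_star, ← Finset.mul_sum]
    have hi : ∀ i, ‖x i‖ ^ 2 ≤ ∑ i, ‖x i‖ ^ 2 := fun i =>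
      Finset.single_le_sum (f := fun i => ‖x i‖ ^ 2) (fun _ _ => by positivity) (Finset.mem_univ i)
    have h2 : ‖x i‖ * ‖x l‖ ≤ ∑ i, ‖x i‖ ^ 2 := by
      nlinarith [hi i, hi l, sq_nonneg (‖x i‖ - ‖x l‖)]
    nlinarith [norm_nonneg (B i l)]
  have h2 := (RCLike.abs_re_le_norm (star x ⬝ᵥ (B *ᵥ x))).trans h1
  linarith [(abs_le.1 h2).1]

/-- Hahn–Banach separation: if `u` has no factorization with constant `C`, there are separating
functionals. -/
theorem exists_separating_functionals {Y : Type*} [NormedAddCommGroup Y] [NormedSpace 𝕜 Y]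
    [NormedSpace ℝ Y] [IsScalarTower ℝ 𝕜 Y] {n : ℕ} (u : Fin n → Y) {C : ℝ} (hC : 0 < C)
    (hu : ¬ ∃ (m : ℕ) (a : Fin m → Fin n → 𝕜) (y : Fin m → Y), (∀ i, u i = ∑ j, a j i • y j) ∧
        (∀ x : Fin n → 𝕜, ∑ j, ‖∑ i, a j i * x i‖ ^ 2 ≤ C ^ 2 * ∑ i, ‖x i‖ ^ 2) ∧
        ∑ j, ‖y j‖ ^ 2 ≤ 1) :
    ∃ (ψ : (Fin n → Y) →ₗ[ℝ] ℝ) (μ : Matrix (Fin n) (Fin n) 𝕜 →ₗ[ℝ] ℝ) (s : ℝ),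
      C ^ 2 * μ 1 + s = 1 ∧ 1 ≤ ψ u ∧ 0 ≤ s ∧
      (∀ a : Fin n → 𝕜, 0 ≤ μ (vecMulVec (star a) a)) ∧
      ∀ (a : Fin n → 𝕜) (y : Y), ψ (fun i => a i • y) ≤ μ (vecMulVec (star a) a) + s * ‖y‖ ^ 2 := by
  set v : (Fin n → Y) × Matrix (Fin n) (Fin n) 𝕜 × ℝ := (0, C ^ 2 • 1, 1) with hv
  have hv0 : v ≠ 0 := fun h => by
    have := congrArg (fun w => w.2.2) h
    simp [hv] at this
  have hone : ∀ (r : ℝ) (x : Fin n → 𝕜), RCLike.re (star x ⬝ᵥ ((r • (1 : Matrix (Fin n) (Fin n) 𝕜)) *ᵥ x))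
      = r * ∑ i, ‖x i‖ ^ 2 := by
    intro r x
    rw [smul_mulVec, one_mulVec, dotProduct_smul, RCLike.smul_re, re_star_dotProduct_self]
  set f := LinearPMap.mkSpanSingleton (σ := RingHom.id ℝ) v (1 : ℝ) hv0
  have hnonneg : ∀ x : f.domain, (x : (Fin n → Y) × Matrix (Fin n) (Fin n) 𝕜 × ℝ)
      ∈ factorizationCone (𝕜 := 𝕜) u C → 0 ≤ f x := by
    rintro ⟨w, hw⟩ hwS
    obtain ⟨r, rfl⟩ := Submodule.mem_span_singleton.1 hw
    have hfr : f ⟨r • v, hw⟩ = r • (1 : ℝ) := LinearPMap.mkSpanSingleton'_apply _ _ _ _ _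
    rw [hfr]
    obtain ⟨t, ht, m, a, y, h1, h2, h3⟩ := hwS
    simp only [hv, Prod.smul_mk, smul_zero, Pi.zero_apply, zero_add, smul_smul, hone,
      smul_eq_mul, mul_one] at h1 h2 h3 ⊢
    -- If r < 0, then t ≥ -r > 0, and scaling both factors by t^{-1/2} yields the excluded
    -- factorization.
    by_contra! hr
    have ht0 : 0 < t := by
      have : 0 ≤ ∑ j, ‖y j‖ ^ 2 := by positivity
      linarith
    refine hu ⟨m, fun j i => ((√t : ℝ) : 𝕜)⁻¹ * a j i, fun j => ((√t : ℝ) : 𝕜)⁻¹ • y j, ?_, ?_, ?_⟩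
    · intro i
      have e : ∀ j, (((√t : ℝ) : 𝕜)⁻¹ * a j i) • ((√t : ℝ) : 𝕜)⁻¹ • y j = (t : 𝕜)⁻¹ • a j i • y j := by
        intro j
        rw [smul_smul, smul_smul]
        congr 1
        rw [← Real.mul_self_sqrt ht, RCLike.ofReal_mul, mul_inv, Real.mul_self_sqrt ht]
        ring
      simp only [e, ← Finset.smul_sum, ← h1]
      rw [smul_smul, inv_mul_cancel₀ (by simpa using ht0.ne'), one_smul]
    · intro x
      have e : ∀ j, ‖∑ i, ((√t : ℝ) : 𝕜)⁻¹ * a j i * x i‖ ^ 2 = t⁻¹ * ‖∑ i, a j i * x i‖ ^ 2 := by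
        intro j
        simp only [mul_assoc, ← Finset.mul_sum]
        rw [norm_mul, mul_pow, norm_inv, RCLike.norm_ofReal, inv_pow, sq_abs, Real.sq_sqrt ht]
      simp only [e, ← Finset.mul_sum]
      rw [inv_mul_le_iff₀ ht0]
      refine (h2 x).trans ?_
      have : 0 ≤ C ^ 2 * ∑ i, ‖x i‖ ^ 2 := by positivity
      nlinarith
    · simp only [norm_smul, mul_pow, norm_inv, RCLike.norm_ofReal, inv_pow, sq_abs,
        Real.sq_sqrt ht, ← Finset.mul_sum]
      rw [inv_mul_le_iff₀ ht0]
      linarith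
  have hdense : ∀ y, ∃ x : f.domain, (x : (Fin n → Y) × Matrix (Fin n) (Fin n) 𝕜 × ℝ) + y
      ∈ factorizationCone (𝕜 := 𝕜) u C := by
    rintro ⟨w, B, r⟩
    obtain ⟨β, hβ, hB⟩ := re_star_dotProduct_mulVec_ge B
    -- Large enough for the trivial decomposition w = ∑ e_j ⊗ w_j, which needs 1 ≤ ρ C² 1 + B and ∑
    -- ‖w_j‖² ≤ ρ + r.
    set ρ : ℝ := (1 + β) / C ^ 2 + |r| + ∑ i, ‖w i‖ ^ 2 with hρ
    have hw : 0 ≤ ∑ i, ‖w i‖ ^ 2 := by positivity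
    have hβC : 0 ≤ (1 + β) / C ^ 2 := by positivity
    have hρC : 1 + β ≤ ρ * C ^ 2 := by
      rw [← div_le_iff₀ (by positivity)]
      linarith [abs_nonneg r]
    refine ⟨⟨ρ • v, Submodule.smul_mem _ _ (Submodule.mem_span_singleton_self v)⟩,
      0, le_rfl, n, fun j => Pi.single j 1, w, ?_, ?_, ?_⟩
    · intro i
      simp [hv, Pi.single_apply, ite_smul]
    · intro x
      have e : ((ρ • v + (w, B, r)).2.1 : Matrix (Fin n) (Fin n) 𝕜) = (ρ * C ^ 2) • 1 + B := by
        simp [hv, smul_smul]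
      change _ ≤ RCLike.re (star x ⬝ᵥ ((ρ • v + (w, B, r)).2.1 *ᵥ x)) + _
      rw [e, add_mulVec, dotProduct_add, map_add, hone]
      have hx : 0 ≤ ∑ i, ‖x i‖ ^ 2 := by positivity
      have e2 : ∑ j, ‖∑ i, (Pi.single j 1 : Fin n → 𝕜) i * x i‖ ^ 2 = ∑ i, ‖x i‖ ^ 2 := by
        simp [Pi.single_apply]
      rw [e2]
      nlinarith [hB x]
    · change _ ≤ (ρ • v + (w, B, r)).2.2 + 0
      have : (ρ • v + (w, B, r)).2.2 = ρ + r := by simp [hv]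
      rw [this]
      linarith [neg_abs_le r]
  obtain ⟨g, hg, hgS⟩ := riesz_extension (factorizationCone (𝕜 := 𝕜) u C) f hnonneg hdense
  have hgv : g v = 1 := by
    have h1 := hg ⟨v, Submodule.mem_span_singleton_self v⟩
    have h2 := LinearPMap.mkSpanSingleton_apply ℝ ℝ (σ := RingHom.id ℝ) hv0 (1 : ℝ)
    simpa using h1.trans h2
  have hsplit : ∀ (w : Fin n → Y) (B : Matrix (Fin n) (Fin n) 𝕜) (r : ℝ),
      g (w, B, r) = g (w, 0, 0) + g (0, B, 0) + r * g (0, 0, 1) := by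
    intro w B r
    rw [← smul_eq_mul, ← map_smul, ← map_add, ← map_add]
    simp
  refine ⟨-(g ∘ₗ LinearMap.inl ℝ _ _),
    g ∘ₗ LinearMap.inr ℝ _ _ ∘ₗ LinearMap.inl ℝ _ _, g (0, 0, 1), ?_, ?_, ?_, ?_, ?_⟩
  · rw [hv, hsplit] at hgv
    have : g ((0 : Fin n → Y), C ^ 2 • (1 : Matrix (Fin n) (Fin n) 𝕜), (0 : ℝ))
        = C ^ 2 * g ((0 : Fin n → Y), (1 : Matrix (Fin n) (Fin n) 𝕜), (0 : ℝ)) := by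
      rw [← smul_eq_mul, ← map_smul]
      simp
    rw [this] at hgv
    have h0 : g ((0 : Fin n → Y), (0 : Matrix (Fin n) (Fin n) 𝕜), (0 : ℝ)) = 0 := map_zero g
    simp only [LinearMap.comp_apply, LinearMap.inl_apply, LinearMap.inr_apply]
    linarith
  -- This point lies in the cone with t = 1 and the empty factorization.
  · have h1 : 0 ≤ g (-(u, 0, 0) - v) := by
      refine hgS _ ⟨1, zero_le_one, 0, fun j => j.elim0, fun j => j.elim0, ?_, ?_, ?_⟩
      · intro i
        simp [hv]
      · intro x
        have : (-(u, 0, 0) - v).2.1 = (-C ^ 2) • (1 : Matrix (Fin n) (Fin n) 𝕜) := by simp [hv]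
        rw [this, hone]
        simp
      · simp [hv]
    rw [map_sub, map_neg, hgv] at h1
    simp only [LinearMap.neg_apply, LinearMap.comp_apply, LinearMap.inl_apply]
    change 1 ≤ -g (u, 0, 0)
    linarith
  · exact hgS _ ⟨0, le_rfl, 0, fun j => j.elim0, fun j => j.elim0, by simp, by simp, by simp⟩
  · intro a
    refine hgS _ ⟨0, le_rfl, 0, fun j => j.elim0, fun j => j.elim0, by simp, ?_, by simp⟩
    intro x
    have := re_star_dotProduct_vecMulVec a x
    simp [this]
  · intro a y
    have h1 : 0 ≤ g (fun i => a i • y, vecMulVec (star a) a, ‖y‖ ^ 2) := by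
      refine hgS _ ⟨0, le_rfl, 1, fun _ => a, fun _ => y, by simp, ?_, by simp⟩
      intro x
      simp only [re_star_dotProduct_vecMulVec]
      simp
    rw [hsplit] at h1
    simp only [LinearMap.neg_apply, LinearMap.comp_apply, LinearMap.inl_apply,
      LinearMap.inr_apply]
    change -g (fun i => a i • y, 0, 0) ≤ _
    linarith

end Factorization

/-! ### Dual Pietsch factorization -/

section Domination

open Matrix

variable {𝕜 : Type*} [RCLike 𝕜] {Y : Type*} [NormedAddCommGroup Y] [NormedSpace 𝕜 Y]
  [NormedSpace ℝ Y] [IsScalarTower ℝ 𝕜 Y] {n : ℕ}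

/-- Replacing y by t c y, with c a unimodular scalar rotating the value to its modulus, gives a
quadratic in t that is nonnegative; its discriminant is at most 0. -/
theorem norm_sq_extendRCLike_le (ψ : (Fin n → Y) →ₗ[ℝ] ℝ) {a : Fin n → 𝕜} {Q s : ℝ}
    (hψ : ∀ y : Y, ψ (fun i => a i • y) ≤ Q + s * ‖y‖ ^ 2) (y : Y) :
    ‖(Module.Dual.extendRCLike ψ : Module.Dual 𝕜 (Fin n → Y)) (fun i => a i • y)‖ ^ 2
      ≤ 4 * (s * ‖y‖ ^ 2) * Q := by
  set w : 𝕜 := (Module.Dual.extendRCLike ψ : Module.Dual 𝕜 (Fin n → Y)) (fun i => a i • y) with hw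
  obtain ⟨c, hc, hcw⟩ : ∃ c : 𝕜, ‖c‖ = 1 ∧ c * w = ‖w‖ := RCLike.exists_norm_eq_mul_self w |>.imp
    fun c h => ⟨h.1, h.2.symm⟩
  have key : ∀ t : ℝ, t * ‖w‖ ≤ Q + s * (t ^ 2 * ‖y‖ ^ 2) := by
    intro t
    have h1 := hψ (((t : 𝕜) * c) • y)
    have h2 : (fun i => a i • ((t : 𝕜) * c) • y) = ((t : 𝕜) * c) • (fun i => a i • y) := by
      funext i
      exact smul_comm _ _ _
    rw [h2, ← Module.Dual.re_extendRCLike_apply (𝕜 := 𝕜) ψ, map_smul, ← hw, smul_eq_mul, mul_assoc,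
      hcw, norm_smul, norm_mul, hc, RCLike.norm_ofReal, mul_one, mul_pow, sq_abs,
      RCLike.re_ofReal_mul, RCLike.ofReal_re] at h1
    exact h1
  have := discrim_le_zero (a := s * ‖y‖ ^ 2) (b := -‖w‖) (c := Q) (fun t => by nlinarith [key t])
  rw [discrim] at this
  linarith

/-- The functionals separating `u` from the factorization cone are controlled by the `2`-summing
inequality. -/
theorem one_le_of_separating_functionals (u : Fin n → Y) {ψ : (Fin n → Y) →ₗ[ℝ] ℝ}
    {μ : Matrix (Fin n) (Fin n) 𝕜 →ₗ[ℝ] ℝ} {s P : ℝ} (hψu : 1 ≤ ψ u) (hs : 0 ≤ s)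
    (hμ : ∀ a : Fin n → 𝕜, 0 ≤ μ (vecMulVec (star a) a))
    (hψ : ∀ (a : Fin n → 𝕜) (y : Y),
      ψ (fun i => a i • y) ≤ μ (vecMulVec (star a) a) + s * ‖y‖ ^ 2)
    (hP : ∀ (g : Fin n → StrongDual 𝕜 Y) (W : ℝ), 0 ≤ W →
      (∀ α : Fin n → 𝕜, ‖∑ i, α i • g i‖ ≤ W * √(∑ i, ‖α i‖ ^ 2)) →
      ∑ i, ∑ l, ‖g i (u l)‖ ^ 2 ≤ P ^ 2 * W ^ 2) :
    1 ≤ μ 1 * (4 * P ^ 2 * s) := by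
  -- The perturbation δ makes R invertible; it tends to 0 at the end.
  have main : ∀ δ : ℝ, 0 < δ → 1 ≤ (μ 1 + n * δ) * (4 * P ^ 2 * s) := by
    intro δ hδ
    obtain ⟨R, hR, hRa⟩ := exists_isUnit_sum_norm_sq_mulVec_eq μ hμ hδ
    have hRdet : IsUnit R.det := (isUnit_iff_isUnit_det R).1 hR
    set Ψ : Module.Dual 𝕜 (Fin n → Y) := Module.Dual.extendRCLike ψ with hΨ
    have hb : ∀ (a : Fin n → 𝕜) (y : Y),
        ‖Ψ (fun i => a i • y)‖ ^ 2 ≤ 4 * (s * ‖y‖ ^ 2) * ∑ i, ‖(R *ᵥ a) i‖ ^ 2 := by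
      intro a y
      refine norm_sq_extendRCLike_le ψ (fun y => (hψ a y).trans ?_) y
      rw [hRa]
      have : 0 ≤ δ * ∑ i, ‖a i‖ ^ 2 := by positivity
      linarith
    have hb' : ∀ (α : Fin n → 𝕜) (y : Y), ‖Ψ (fun i => (R⁻¹ *ᵥ α) i • y)‖
        ≤ (2 * √s * √(∑ i, ‖α i‖ ^ 2)) * ‖y‖ := by
      intro α y
      refine le_of_sq_le_sq ?_ (by positivity)
      have := hb (R⁻¹ *ᵥ α) y
      rw [mulVec_mulVec, mul_nonsing_inv _ hRdet, one_mulVec] at this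
      refine this.trans (le_of_eq ?_)
      rw [mul_pow, mul_pow, mul_pow, Real.sq_sqrt hs, Real.sq_sqrt (by positivity)]
      ring
    -- In the coordinates α = R a, the pairing Ψ(a ⊗ y) becomes an operator from ℓ² to Y* of norm at
    -- most 2√s, to which the 2-summing bound applies.
    let G : (Fin n → 𝕜) → StrongDual 𝕜 Y := fun α =>
      (Ψ ∘ₗ LinearMap.pi (fun l => (R⁻¹ *ᵥ α) l • (LinearMap.id : Y →ₗ[𝕜] Y))).mkContinuous
        (2 * √s * √(∑ i, ‖α i‖ ^ 2)) (hb' α)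
    have hG : ∀ α y, G α y = Ψ (fun i => (R⁻¹ *ᵥ α) i • y) := fun _ _ => rfl
    have hGn : ∀ α, ‖G α‖ ≤ 2 * √s * √(∑ i, ‖α i‖ ^ 2) := fun α =>
      LinearMap.mkContinuous_norm_le _ (by positivity) _
    have hGsum : ∀ α, ∑ i, α i • G (Pi.single i 1) = G α := by
      intro α
      ext y
      rw [_root_.sum_apply]
      simp only [_root_.smul_apply, hG, ← map_smul, ← map_sum]
      congr 1
      funext l
      rw [Finset.sum_apply]
      simp only [Pi.smul_apply, mulVec_single_one, smul_smul, ← Finset.sum_smul]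
      congr 1
      simp only [mulVec, dotProduct, col_apply]
      exact Finset.sum_congr rfl fun _ _ => mul_comm _ _
    have h1 := hP (fun i => G (Pi.single i 1)) (2 * √s) (by positivity) (fun α => by
      rw [hGsum]; exact hGn α)
    -- Trace duality: Ψ(u) pairs R, of squared Hilbert–Schmidt norm μ(1) + nδ, with the values
    -- controlled by `hP`; Cauchy–Schwarz concludes.
    have hu : Ψ u = ∑ l, ∑ i, R i l * G (Pi.single i 1) (u l) := by
      have h2 : ∀ l, ∑ i, R i l * G (Pi.single i 1) (u l) = Ψ (Pi.single l (u l)) := by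
        intro l
        have h3 := congrArg (fun F : StrongDual 𝕜 Y => F (u l)) (hGsum (fun i => R i l))
        simp only [_root_.sum_apply, _root_.smul_apply,
          smul_eq_mul] at h3
        rw [h3, hG]
        congr 1
        have h4 : (fun i => R i l) = R *ᵥ Pi.single l 1 := by
          rw [mulVec_single_one]
          rfl
        rw [h4, mulVec_mulVec, nonsing_inv_mul _ hRdet, one_mulVec]
        funext i
        by_cases h : i = l
        · subst h; simp
        · simp [h]
      simp only [h2, ← map_sum]
      rw [Finset.univ_sum_single]
    have hR2 : ∑ l, ∑ i, ‖R i l‖ ^ 2 = μ 1 + n * δ := by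
      have h2 : ∀ l, ∑ i, ‖R i l‖ ^ 2 = μ (vecMulVec (star (Pi.single l 1)) (Pi.single l 1)) + δ := by
        intro l
        have h3 := hRa (Pi.single l 1)
        have h4 : ∑ i, ‖(Pi.single l 1 : Fin n → 𝕜) i‖ ^ 2 = 1 := by
          rw [Finset.sum_eq_single l (fun i _ hi => by simp [hi]) (by simp)]
          simp
        rw [h4, mul_one, mulVec_single_one] at h3
        exact h3
      simp only [h2, Finset.sum_add_distrib, ← map_sum]
      congr 1
      · congr 1
        ext i j
        rw [Matrix.sum_apply]
        simp only [vecMulVec_apply, Pi.star_apply, Matrix.one_apply, Pi.single_apply]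
        rw [Finset.sum_eq_single i (fun l _ hl => by simp [Ne.symm hl]) (by simp)]
        simp [eq_comm]
      · simp
    have h5 : (1 : ℝ) ≤ ∑ x : Fin n × Fin n, ‖R x.2 x.1‖ * ‖G (Pi.single x.2 1) (u x.1)‖ := by
      calc (1 : ℝ) ≤ RCLike.re (Ψ u) := by rwa [hΨ, Module.Dual.re_extendRCLike_apply]
        _ ≤ ‖Ψ u‖ := RCLike.re_le_norm _
        _ ≤ _ := by
          rw [hu, Fintype.sum_prod_type]
          refine (norm_sum_le _ _).trans (Finset.sum_le_sum fun l _ => ?_)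
          refine (norm_sum_le _ _).trans (Finset.sum_le_sum fun i _ => ?_)
          rw [norm_mul]
    have h6 := Finset.sum_mul_sq_le_sq_mul_sq (Finset.univ : Finset (Fin n × Fin n))
      (fun x => ‖R x.2 x.1‖) (fun x => ‖G (Pi.single x.2 1) (u x.1)‖)
    rw [Fintype.sum_prod_type (fun x : Fin n × Fin n => ‖R x.2 x.1‖ ^ 2), hR2,
      Fintype.sum_prod_type (fun x : Fin n × Fin n => ‖G (Pi.single x.2 1) (u x.1)‖ ^ 2),
      Finset.sum_comm] at h6
    have hR0 : 0 ≤ μ 1 + n * δ := by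
      rw [← hR2]
      positivity
    calc (1 : ℝ) ≤ _ ^ 2 := one_le_pow₀ h5
      _ ≤ _ := h6
      _ ≤ (μ 1 + n * δ) * (P ^ 2 * (2 * √s) ^ 2) := by gcongr
      _ = _ := by
        rw [mul_pow, Real.sq_sqrt hs]
        ring
  refine le_of_forall_pos_le_add fun η hη => ?_
  have hp : 0 ≤ n * (4 * P ^ 2 * s) := by positivity
  have h1 := main (η / (n * (4 * P ^ 2 * s) + 1)) (by positivity)
  have h2 : n * (η / (n * (4 * P ^ 2 * s) + 1)) * (4 * P ^ 2 * s) ≤ η := by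
    have : n * (η / (n * (4 * P ^ 2 * s) + 1)) * (4 * P ^ 2 * s)
        = η * (n * (4 * P ^ 2 * s) / (n * (4 * P ^ 2 * s) + 1)) := by
      ring
    rw [this]
    exact mul_le_of_le_one_right hη.le ((div_le_one (by positivity)).2 (by linarith))
  linarith [add_mul (μ 1) (n * (η / (n * (4 * P ^ 2 * s) + 1))) (4 * P ^ 2 * s)]

/-- Finite-dimensional dual form of Pietsch's factorization theorem. -/
theorem exists_factorization (u : Fin n → Y) {P C : ℝ} (hP0 : 0 ≤ P) (hPC : P < C)
    (hP : ∀ (g : Fin n → StrongDual 𝕜 Y) (W : ℝ), 0 ≤ W →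
      (∀ α : Fin n → 𝕜, ‖∑ i, α i • g i‖ ≤ W * √(∑ i, ‖α i‖ ^ 2)) →
      ∑ i, ∑ l, ‖g i (u l)‖ ^ 2 ≤ P ^ 2 * W ^ 2) :
    ∃ (m : ℕ) (a : Fin m → Fin n → 𝕜) (y : Fin m → Y), (∀ i, u i = ∑ j, a j i • y j) ∧
      (∀ x : Fin n → 𝕜, ∑ j, ‖∑ i, a j i * x i‖ ^ 2 ≤ C ^ 2 * ∑ i, ‖x i‖ ^ 2) ∧
      ∑ j, ‖y j‖ ^ 2 ≤ 1 := by
  by_contra hu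
  obtain ⟨ψ, μ, s, h1, hψu, hs, hμ, hψ⟩ := exists_separating_functionals u (hP0.trans_lt hPC) hu
  have h2 := one_le_of_separating_functionals u hψu hs hμ hψ hP
  have h3 : 0 < μ 1 * (4 * s) := by
    by_contra! h
    nlinarith [sq_nonneg P]
  have h4 : P ^ 2 < C ^ 2 := by gcongr
  -- AM–GM gives 4 C² μ(1) s ≤ (C² μ(1) + s)² = 1, against 1 ≤ 4 P² μ(1) s < 4 C² μ(1) s.
  nlinarith [sq_nonneg (C ^ 2 * μ 1 - s)]

end Domination

/-! ### Upper bound from the 2-summing norm -/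

section Upper

variable {𝕜 : Type*} [RCLike 𝕜] {H : Type*} [NormedAddCommGroup H] [InnerProductSpace 𝕜 H]
  [CompleteSpace H] {Y : Type*} [NormedAddCommGroup Y] [NormedSpace 𝕜 Y]

/-- Test the bound on α_i = conj F(g_i). -/
theorem weakL2Norm_le_ofReal {X : Type*} [NormedAddCommGroup X] [NormedSpace 𝕜 X] {n : ℕ}
    (g : Fin n → X) {W : ℝ} (hW : 0 ≤ W)
    (hg : ∀ α : Fin n → 𝕜, ‖∑ i, α i • g i‖ ≤ W * √(∑ i, ‖α i‖ ^ 2)) :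
    weakL2Norm 𝕜 g ≤ ENNReal.ofReal W := by
  refine iSup₂_le fun F hF => ENNReal.ofReal_le_ofReal ?_
  set T := ∑ i, ‖F (g i)‖ ^ 2 with hT
  have hT0 : 0 ≤ T := by positivity
  have h1 : F (∑ i, star (F (g i)) • g i) = (T : 𝕜) := by
    simp [hT, RCLike.conj_mul]
  have h2 : T ≤ W * √T := by
    calc T = ‖F (∑ i, star (F (g i)) • g i)‖ := by
          rw [h1, RCLike.norm_ofReal, abs_of_nonneg hT0]
      _ ≤ 1 * ‖∑ i, star (F (g i)) • g i‖ := F.le_of_opNorm_le hF _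
      _ ≤ W * √(∑ i, ‖star (F (g i))‖ ^ 2) := by rw [one_mul]; exact hg _
      _ = W * √T := by simp only [norm_star, hT]
  rcases (Real.sqrt_nonneg T).eq_or_lt with h | h
  · rwa [← h]
  · refine le_of_mul_le_mul_right ?_ h
    rwa [Real.mul_self_sqrt hT0]

theorem norm_tensorPowerMap_le_of_twoSumming (φ : H →L[𝕜] Y) {c : ℝ≥0}
    (hc : ∀ (n : ℕ) (x : Fin n → StrongDual 𝕜 Y),
      ENNReal.ofReal (√(∑ i, ‖dualOp φ (x i)‖ ^ 2)) ≤ c * weakL2Norm 𝕜 x)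
    {C : ℝ} (hcC : c < C) (k : ℕ) (z : ⨂[𝕜]^k H) :
    ‖tensorPowerMap (φ : H →ₗ[𝕜] Y) k z‖ ≤ C ^ k * hilbertNorm z := by
  let _ : NormedSpace ℝ Y := NormedSpace.restrictScalars ℝ 𝕜 Y
  have : IsScalarTower ℝ 𝕜 Y := RestrictScalars.isScalarTower _ _ _
  refine norm_tensorPowerMap_le_of_factorization φ (c.coe_nonneg.trans hcC.le) (fun n e he => ?_) k z
  refine exists_factorization (fun i => φ (e i)) c.coe_nonneg hcC fun g W hW hg => ?_
  have h1 := (hc n g).trans (mul_le_mul_right (weakL2Norm_le_ofReal g hW hg) _)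
  rw [← ENNReal.ofReal_coe_nnreal, ← ENNReal.ofReal_mul c.coe_nonneg,
    ENNReal.ofReal_le_ofReal_iff (by positivity)] at h1
  have h2 : ∑ i, ‖dualOp φ (g i)‖ ^ 2 ≤ (c : ℝ) ^ 2 * W ^ 2 := by
    rw [← mul_pow]
    exact (Real.sqrt_le_left (by positivity)).1 h1
  -- Bessel: ∑_l |g_i(φ e_l)|² ≤ ‖φ* g_i‖², through the Riesz representative.
  refine le_trans (Finset.sum_le_sum fun i _ => ?_) h2
  set h := (InnerProductSpace.toDual 𝕜 H).symm (dualOp φ (g i)) with hh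
  have h3 : ‖h‖ = ‖dualOp φ (g i)‖ := by simp [hh]
  rw [← h3]
  refine le_trans (le_of_eq ?_) (he.sum_inner_products_le h (s := Finset.univ))
  refine Finset.sum_congr rfl fun l _ => ?_
  rw [norm_inner_symm, hh, InnerProductSpace.toDual_symm_apply]
  rfl

end Upper

/-! ### Passage to k-th roots -/

section RootLimits

variable {𝕜 : Type*} [RCLike 𝕜] {H : Type*} [NormedAddCommGroup H] [InnerProductSpace 𝕜 H]
  {Y : Type*} [NormedAddCommGroup Y] [NormedSpace 𝕜 Y]

theorem coe_pow_rpow_one_div (C : ℝ≥0) {k : ℕ} (hk : k ≠ 0) :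
    ((C : ℝ≥0∞) ^ k) ^ (1 / (k : ℝ)) = C := by
  rw [one_div, ← ENNReal.rpow_natCast, ENNReal.rpow_rpow_inv (by exact_mod_cast hk)]

theorem limsup_hilbertToProjNorm_le [CompleteSpace H] (φ : H →L[𝕜] Y) :
    limsup (fun k : ℕ => hilbertToProjNorm φ k ^ (1 / (k : ℝ))) atTop
      ≤ twoSummingNorm (dualOp φ) := by
  refine le_of_forall_gt fun b hb => ?_
  obtain ⟨c, hc⟩ := iInf_lt_iff.1 hb
  obtain ⟨hc, hcb⟩ := iInf_lt_iff.1 hc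
  obtain ⟨C, hcC, hCb⟩ := ENNReal.lt_iff_exists_nnreal_btwn.1 hcb
  refine lt_of_le_of_lt ?_ hCb
  refine limsup_le_of_le (h := ?_)
  filter_upwards [eventually_ne_atTop 0] with k hk
  rw [← coe_pow_rpow_one_div C hk]
  refine ENNReal.rpow_le_rpow ?_ (by positivity)
  refine (iInf₂_le (C ^ k) fun z => ?_).trans (by simp)
  have := norm_tensorPowerMap_le_of_twoSumming φ hc (C := C) (by exact_mod_cast hcC) k z
  simpa using this

theorem exists_dual_family_of_lt_twoSummingNorm (φ : H →L[𝕜] Y) {a : ℝ≥0} (ha : 0 < a)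
    (haφ : a < twoSummingNorm (dualOp φ)) :
    ∃ (m : ℕ) (g : Fin m → StrongDual 𝕜 Y), (∀ y : Y, ‖y‖ ≤ 1 → ∑ i, ‖g i y‖ ^ 2 ≤ 1) ∧
      (a : ℝ) ^ 2 < ∑ i, ‖(g i).comp φ‖ ^ 2 := by
  obtain ⟨m, x, hx⟩ : ∃ (m : ℕ) (x : Fin m → StrongDual 𝕜 Y),
      a * weakL2Norm 𝕜 x < ENNReal.ofReal (√(∑ i, ‖dualOp φ (x i)‖ ^ 2)) := by
    by_contra! h
    exact absurd haφ (not_lt.2 (iInf₂_le a h))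
  have ha' : (a : ℝ≥0∞) ≠ 0 := by exact_mod_cast ha.ne'
  rw [mul_comm, ← ENNReal.lt_div_iff_mul_lt (Or.inl ha') (Or.inl ENNReal.coe_ne_top)] at hx
  -- Normalizing by W strictly above the weak norm ensures W > 0 even if that norm vanishes, and
  -- keeps the strict inequality.
  obtain ⟨W, hW, hWx⟩ := ENNReal.lt_iff_exists_nnreal_btwn.1 hx
  have hW0 : 0 < W := by exact_mod_cast zero_le.trans_lt hW
  rw [ENNReal.lt_div_iff_mul_lt (Or.inl ha') (Or.inl ENNReal.coe_ne_top), ← ENNReal.coe_mul,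
    ← ENNReal.ofReal_coe_nnreal, ENNReal.ofReal_lt_ofReal_iff_of_nonneg (by positivity),
    Real.lt_sqrt (by positivity)] at hWx
  have hW2 : (0 : ℝ) < (W : ℝ) ^ 2 := by positivity
  have hnW : ‖((W : ℝ) : 𝕜)⁻¹‖ ^ 2 = ((W : ℝ) ^ 2)⁻¹ := by
    rw [norm_inv, RCLike.norm_ofReal, inv_pow, sq_abs]
  refine ⟨m, fun i => ((W : ℝ) : 𝕜)⁻¹ • x i, fun y hy => ?_, ?_⟩
  · have h1 : ENNReal.ofReal (√(∑ i, ‖x i y‖ ^ 2)) ≤ weakL2Norm 𝕜 x :=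
      le_iSup₂_of_le (NormedSpace.inclusionInDoubleDual 𝕜 Y y)
        ((NormedSpace.double_dual_bound 𝕜 Y y).trans hy) le_rfl
    have h2 := h1.trans hW.le
    rw [← ENNReal.ofReal_coe_nnreal, ENNReal.ofReal_le_ofReal_iff W.coe_nonneg,
      Real.sqrt_le_left W.coe_nonneg] at h2
    simp only [_root_.smul_apply, norm_smul, mul_pow, hnW, ← Finset.mul_sum]
    rw [inv_mul_le_iff₀ hW2, mul_one]
    exact h2
  · have h1 : ∀ i, (((W : ℝ) : 𝕜)⁻¹ • x i).comp φ = ((W : ℝ) : 𝕜)⁻¹ • dualOp φ (x i) :=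
      fun i => rfl
    simp only [h1, norm_smul, mul_pow, hnW, ← Finset.mul_sum]
    rw [lt_inv_mul_iff₀ hW2, ← mul_pow]
    exact_mod_cast hWx

theorem le_liminf_hilbertToProjNorm [CompleteSpace H] [FiniteDimensional 𝕜 Y] (φ : H →L[𝕜] Y) :
    twoSummingNorm (dualOp φ)
      ≤ liminf (fun k : ℕ => hilbertToProjNorm φ k ^ (1 / (k : ℝ))) atTop := by
  refine le_of_forall_lt fun b hb => ?_
  obtain ⟨a, hba, haφ⟩ := ENNReal.lt_iff_exists_nnreal_btwn.1 hb
  have ha : 0 < a := by exact_mod_cast zero_le.trans_lt hba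
  refine lt_of_lt_of_le hba ?_
  obtain ⟨m, g, hg, hag⟩ := exists_dual_family_of_lt_twoSummingNorm φ ha haφ
  refine le_liminf_of_le (h := ?_)
  filter_upwards [eventually_ne_atTop 0, eventually_pow_le_of_norm_tensorPowerMap_le φ g hg
    (a := a) (by exact_mod_cast ha) hag] with k hk h
  rw [← coe_pow_rpow_one_div a hk]
  refine ENNReal.rpow_le_rpow ?_ (by positivity)
  refine le_iInf₂ fun D hD => ?_
  exact_mod_cast h D D.coe_nonneg hD

end RootLimits

end TensorRadius

theorem mainTheorem5 {𝕜 : Type*} [RCLike 𝕜]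
    {H : Type*} [NormedAddCommGroup H] [InnerProductSpace 𝕜 H] [CompleteSpace H]
    {Y : Type*} [NormedAddCommGroup Y] [NormedSpace 𝕜 Y] [CompleteSpace Y]
    (φ : H →L[𝕜] Y) :
    limsup (fun k : ℕ => TensorRadius.hilbertToProjNorm φ k ^ (1 / (k : ℝ))) atTop
        ≤ TensorRadius.twoSummingNorm (TensorRadius.dualOp φ) ∧
    (FiniteDimensional 𝕜 H → FiniteDimensional 𝕜 Y →
      Tendsto (fun k : ℕ => TensorRadius.hilbertToProjNorm φ k ^ (1 / (k : ℝ))) atTop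
        (𝓝 (TensorRadius.twoSummingNorm (TensorRadius.dualOp φ)))) :=
  ⟨TensorRadius.limsup_hilbertToProjNorm_le φ, fun _ _ =>
    tendsto_of_le_liminf_of_limsup_le (TensorRadius.le_liminf_hilbertToProjNorm φ)
      (TensorRadius.limsup_hilbertToProjNorm_le φ)⟩
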